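/- Let $f\in\mathbb{Z}[X]$ be a monic irreducible polynomial of degree $d\ge 2$ which is even, i.e. $f(-X)=f(X)$. For a positive integer $N$ put $$\ell_f(N)=\operatorname{rad}\operatorname{lcm}\{f(1),\dots,f(N)\}=\operatorname{rad}\bigl(|f(1)\cdots f(N)|\bigr),$$ where $\operatorname{rad}(k)$ denotes the product of the distinct primes dividing $k$. Then there is a constant $C$, depending only on $f$, such that for every integer $N\ge 1$ $$\log \ell_f(N)\;\ge\;\frac{8(d-1)}{d(3d-2)}\,N\log N-C\,N .$$ Moreover, for $d>2$ the coefficient $\frac{8(d-1)}{d(3d-2)}$ is strictly larger than $\frac{2}{d}$ (the coefficient in Sah's bound $\log\ell_f(N)\ge(1+o(1))\frac2d N\log N$). -/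

import Mathlib

open Polynomial

/-- `Q_f(N) = |f(1) ⋯ f(N)|`. -/
def Qf (f : ℤ[X]) (N : ℕ) : ℕ :=
  (∏ n ∈ Finset.Icc 1 N, f.eval (n : ℤ)).natAbs

/-- `L_f(N) = lcm {f(1), …, f(N)}`, as a natural number. -/
def Lf (f : ℤ[X]) (N : ℕ) : ℕ :=
  (Finset.Icc 1 N).lcm fun n => (f.eval (n : ℤ)).natAbs

/-- `ℓ_f(N) = rad lcm {f(1), …, f(N)}`, where `rad k` is the product of the distinct primes
dividing `k`. -/
noncomputable def ellf (f : ℤ[X]) (N : ℕ) : ℕ :=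
  UniqueFactorizationMonoid.radical (Lf f N)

/-- The radical of the lcm is also the radical of the product `|f(1) ⋯ f(N)|`. -/
theorem ellf_eq_radical_Qf (f : ℤ[X]) (N : ℕ) :
    ellf f N = UniqueFactorizationMonoid.radical (Qf f N) := by
  have hQ : Qf f N = ∏ n ∈ Finset.Icc 1 N, (f.eval (n : ℤ)).natAbs := by
    unfold Qf
    exact map_prod Int.natAbsHom _ _
  have h0 : Lf f N = 0 ↔ Qf f N = 0 := by
    rw [hQ, Finset.prod_eq_zero_iff, Lf, Finset.lcm_eq_zero_iff]
  unfold ellf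
  by_cases hz : Lf f N = 0
  · rw [hz, h0.1 hz]
  · have hz' : Qf f N ≠ 0 := fun h => hz (h0.2 h)
    have key : (Lf f N).primeFactors = (Qf f N).primeFactors := by
      ext p
      rw [Nat.mem_primeFactors_of_ne_zero hz, Nat.mem_primeFactors_of_ne_zero hz']
      refine and_congr_right fun hp => ⟨fun h => h.trans ?_, fun h => ?_⟩
      · rw [hQ]
        exact Finset.lcm_dvd fun n hn => Finset.dvd_prod_of_mem _ hn
      · rw [hQ, hp.prime.dvd_finsetProd_iff] at h
        obtain ⟨n, hn, hd⟩ := h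
        exact hd.trans (Finset.dvd_lcm hn)
    rw [Nat.radical_eq_prod_primeFactors, Nat.radical_eq_prod_primeFactors, key]

/-! Weigh `log Q_f(N)`, which is at least `d N log N - O(N)` (`exists_le_log_Qf`), against its prime
factors, split at `c N`. Primes `p ≤ c N` contribute at most `N log N + O(N)`
(`exists_sum_factorization_Qf_mul_log_le`). Each root of `f` mod `p` costs about `N log p / (p -
1)`, and Nagell's bound `∑ ρ(p) log p / p ≤ log x + O(1)` applies, where `ρ(p)` is the number of
roots. That bound needs no zeta function: in the order `ℤ[X]/(f)`, take a box of about `x` elements.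
Cauchy–Schwarz forces many pairs to coincide under each ring map to `ZMod p`, while the norm of each
difference is `O(x)` and is divisible by the corresponding powers of `p`. A prime `p > c N` divides
`Q_f(N)` at most `(d/2)^2` times (`exists_four_mul_factorization_Qf_le`). Here evenness enters:
`f(n) = G(n^2 - s)` with `deg G = D = d/2`. If `p^a` divides `f` at `k + 1` arguments, it divides
the divided difference of `G` of order `k` at the points `n^2 - s`, whose differences `(n - m)(n +
m)` are prime to `p`. Its size `O(N^(2D - 2k))` forces `a + 2k < 2D`; summing over `a` gives `D^2`.
Hence `(d^2/4) log ℓ_f(N) ≥ (d - 1) N log N - O(N)`. The resulting coefficient `4(d - 1)/d^2` is at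
least the stated one, because `3d - 2 ≥ 2d`. -/

/-- Cauchy–Schwarz for the number of coincidences of a map. -/
theorem card_sq_le_card_mul_card_coincidences {S Z : Type*} [Fintype S] [Fintype Z]
    [DecidableEq Z] (φ : S → Z) :
    Fintype.card S ^ 2 ≤
      Fintype.card Z * (Finset.univ.filter fun q : S × S => φ q.1 = φ q.2).card := by
  have h1 : Fintype.card S = ∑ z : Z, (Finset.univ.filter fun s => φ s = z).card :=
    Finset.card_eq_sum_card_fiberwise (f := φ) (s := Finset.univ) (t := Finset.univ)
      (by intro x _; simp)
  have h2 : (Finset.univ.filter fun q : S × S => φ q.1 = φ q.2).card =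
      ∑ z : Z, (Finset.univ.filter fun s => φ s = z).card ^ 2 := by
    rw [Finset.card_eq_sum_card_fiberwise (f := fun q : S × S => φ q.1) (t := Finset.univ)
      (by intro x _; simp)]
    refine Finset.sum_congr rfl fun z _ => ?_
    rw [sq, ← Finset.card_product]
    congr 1
    ext ⟨a, b⟩
    simp only [Finset.mem_filter, Finset.mem_univ, true_and, Finset.mem_product]
    constructor
    · rintro ⟨h, h'⟩; exact ⟨h', h ▸ h'⟩
    · rintro ⟨h, h'⟩; exact ⟨h.trans h'.symm, h⟩
  rw [h2]
  conv_lhs => rw [h1]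
  exact sq_sum_le_card_mul_sum_sq

/-! ### Ring maps to `ZMod p` and divisibility of norms in an order. -/

section FreeDomain

variable {A : Type*} [CommRing A] {p : ℕ}

theorem ringHom_zmod_eq_of_ker_le [Fact p.Prime] {φ ψ : A →+* ZMod p}
    (h : RingHom.ker φ ≤ RingHom.ker ψ) : φ = ψ := by
  ext a
  obtain ⟨n, hn⟩ := ZMod.intCast_surjective (φ a)
  have h1 : a - (n : A) ∈ RingHom.ker φ := by
    rw [RingHom.mem_ker, map_sub, map_intCast, hn, sub_self]
  have h2 := h h1
  rw [RingHom.mem_ker, map_sub, map_intCast, sub_eq_zero] at h2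
  rw [h2, hn]

/-- Chinese remainder theorem: distinct maps have distinct, hence comaximal, maximal kernels. -/
theorem pi_ringHom_zmod_surjective [Fact p.Prime] (H : Finset (A →+* ZMod p)) :
    Function.Surjective (RingHom.pi fun φ : H => (φ : A →+* ZMod p)) := by
  classical
  intro y
  have hsurj : ∀ φ : A →+* ZMod p, Function.Surjective φ := fun φ => ZMod.ringHom_surjective φ
  have hco : Pairwise fun i j : H => IsCoprime (RingHom.ker (i : A →+* ZMod p))
      (RingHom.ker (j : A →+* ZMod p)) := by
    intro i j hij
    have hi := RingHom.ker_isMaximal_of_surjective _ (hsurj (i : A →+* ZMod p))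
    have hj := RingHom.ker_isMaximal_of_surjective _ (hsurj (j : A →+* ZMod p))
    rw [Ideal.isCoprime_iff_sup_eq]
    refine Ideal.IsMaximal.coprime_of_ne hi hj fun h => hij ?_
    exact Subtype.ext (ringHom_zmod_eq_of_ker_le h.le)
  choose x hx using fun i : H => hsurj i (y i)
  obtain ⟨a, ha⟩ := Ideal.exists_forall_sub_mem_ideal hco x
  refine ⟨a, funext fun i => ?_⟩
  have := ha i
  rw [RingHom.mem_ker, map_sub, sub_eq_zero] at this
  simpa [hx] using this

/-- Multiplication by `β` carries a `ℤ`-basis of `A` to one of the ideal, so its determinant is the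
index up to sign. -/
theorem natAbs_norm_eq_card_quotient_span [IsDomain A] [Module.Free ℤ A] [Module.Finite ℤ A]
    {β : A} (hβ : β ≠ 0) : (Algebra.norm ℤ β).natAbs = Nat.card (A ⧸ Ideal.span {β}) := by
  classical
  let b := Module.Free.chooseBasis ℤ A
  have := Submodule.natAbs_det_equiv ((Ideal.span {β}).restrictScalars ℤ)
    (b.equiv (Ideal.basisSpanSingleton b hβ) (Equiv.refl _))
  rw [Algebra.norm_apply]
  refine Eq.trans ?_ this
  congr 1
  congr 1
  refine b.ext fun i => ?_
  have h1 := b.equiv_apply i (Ideal.basisSpanSingleton b hβ) (Equiv.refl _)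
  have h2 := Ideal.basisSpanSingleton_apply b hβ i
  exact h2.symm.trans (congrArg Subtype.val h1.symm)

/-- The quotient by `β` surjects onto `(ZMod p)^H`. This replaces ideal factorization, so `A` need
not be integrally closed. -/
theorem pow_card_dvd_natAbs_norm [IsDomain A] [Module.Free ℤ A] [Module.Finite ℤ A]
    [Fact p.Prime] {β : A} (hβ : β ≠ 0) (H : Finset (A →+* ZMod p)) (hH : ∀ φ ∈ H, φ β = 0) :
    p ^ H.card ∣ (Algebra.norm ℤ β).natAbs := by
  rw [natAbs_norm_eq_card_quotient_span hβ]
  let Ψ : (A ⧸ Ideal.span {β}) →+* (H → ZMod p) :=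
    Ideal.Quotient.lift _ (RingHom.pi fun φ : H => (φ : A →+* ZMod p)) (by
      intro a ha
      obtain ⟨c, rfl⟩ := Ideal.mem_span_singleton.1 ha
      have h0 : (RingHom.pi fun φ : H => (φ : A →+* ZMod p)) β = 0 := funext fun i => hH i i.2
      rw [map_mul, h0, zero_mul])
  have hΨ : Function.Surjective Ψ := Ideal.Quotient.lift_surjective_of_surjective _ _
    (pi_ringHom_zmod_surjective H)
  have := AddSubgroup.card_dvd_of_surjective Ψ.toAddMonoidHom hΨ
  simpa [Nat.card_fun] using this

end FreeDomain

theorem sum_mul_log_le_log_of_pow_dvd {P : Finset ℕ} (hP : ∀ p ∈ P, p.Prime) {k : ℕ → ℕ}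
    {n : ℕ} (hn : n ≠ 0) (h : ∀ p ∈ P, p ^ k p ∣ n) :
    ∑ p ∈ P, (k p : ℝ) * Real.log p ≤ Real.log n := by
  have h1 : ∏ p ∈ P, p ^ k p ∣ n := by
    refine Finset.prod_dvd_of_isRelPrime (fun p hp q hq hpq => ?_) h
    exact Nat.coprime_iff_isRelPrime.1
      (Nat.Coprime.pow _ _ ((Nat.coprime_primes (hP p hp) (hP q hq)).2 hpq))
  have h2 : Real.log ((∏ p ∈ P, p ^ k p : ℕ) : ℝ) ≤ Real.log n :=
    Real.log_le_log (by exact_mod_cast Nat.pos_of_dvd_of_pos h1 (Nat.pos_of_ne_zero hn))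
      (by exact_mod_cast Nat.le_of_dvd (Nat.pos_of_ne_zero hn) h1)
  rw [Nat.cast_prod, Real.log_prod (fun p hp => by
    exact_mod_cast (pow_pos (hP p hp).pos _).ne')] at h2
  simpa [Real.log_pow] using h2

theorem exists_pow_between {n x : ℕ} (hn : n ≠ 0) (hx : 1 ≤ x) :
    ∃ B : ℕ, 1 ≤ B ∧ x ≤ B ^ n ∧ B ^ n ≤ 2 ^ n * x := by
  have hex : ∃ B : ℕ, x ≤ B ^ n := ⟨x, Nat.le_self_pow hn x⟩
  classical
  have h1 := Nat.find_spec hex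
  have h2 := @Nat.find_min _ _ hex
  set B := Nat.find hex
  have hB : 1 ≤ B := by
    rcases Nat.eq_zero_or_pos B with h | h
    · rw [h, zero_pow hn] at h1; omega
    · exact h
  refine ⟨B, hB, h1, ?_⟩
  obtain ⟨m, hm⟩ : ∃ m, B = m + 1 := ⟨B - 1, by omega⟩
  have h3 : m ^ n < x := not_le.1 (h2 (m := m) (by omega))
  rcases Nat.eq_zero_or_pos m with h | h
  · rw [hm, h, zero_add, one_pow]; exact Nat.mul_pos (by positivity) hx
  · calc B ^ n ≤ (2 * m) ^ n := Nat.pow_le_pow_left (by omega) n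
      _ = 2 ^ n * m ^ n := mul_pow _ _ _
      _ ≤ 2 ^ n * x := Nat.mul_le_mul_left _ h3.le

/-! ### Mertens' upper bound by averaging over a box. -/

section Averaging

variable {A : Type*} [CommRing A] [IsDomain A] [Module.Free ℤ A] [Module.Finite ℤ A]

open Classical in
theorem sum_card_filter_mul_log_le {β : A} (hβ : β ≠ 0) (x : ℕ)
    (H : ∀ p, Finset (A →+* ZMod p)) :
    ∑ p ∈ Nat.primesLE x, (((H p).filter fun φ => φ β = 0).card : ℝ) * Real.log p ≤
      Real.log (Algebra.norm ℤ β).natAbs := by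
  have h0 : (Algebra.norm ℤ β).natAbs ≠ 0 :=
    Int.natAbs_ne_zero.2 (Algebra.norm_ne_zero_iff.2 hβ)
  refine sum_mul_log_le_log_of_pow_dvd (fun p hp => (Nat.mem_primesLE.1 hp).2) h0
    fun p hp => ?_
  have : Fact p.Prime := ⟨(Nat.mem_primesLE.1 hp).2⟩
  exact pow_card_dvd_natAbs_norm hβ _ fun φ hφ => (Finset.mem_filter.1 hφ).2

omit [IsDomain A] [Module.Free ℤ A] [Module.Finite ℤ A] in
open Classical in
theorem le_card_offDiag_coincidences {S : Type*} [Fintype S] (e : S → A) {p : ℕ}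
    (hp : p.Prime) (φ : A →+* ZMod p) :
    (Fintype.card S : ℝ) ^ 2 / p - Fintype.card S ≤
      ((Finset.univ.filter fun q : S × S => q.1 ≠ q.2 ∧ φ (e q.1 - e q.2) = 0).card : ℝ) := by
  have : Fact p.Prime := ⟨hp⟩
  have h1 := card_sq_le_card_mul_card_coincidences fun s => φ (e s)
  rw [ZMod.card] at h1
  have h2 : (Finset.univ.filter fun q : S × S => φ (e q.1) = φ (e q.2)).card ≤
      (Finset.univ.filter fun q : S × S => q.1 ≠ q.2 ∧ φ (e q.1 - e q.2) = 0).card +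
        Fintype.card S := by
    rw [← Finset.card_univ (α := S), ← Finset.diag_card (Finset.univ : Finset S)]
    refine le_trans (Finset.card_le_card fun q hq => ?_) (Finset.card_union_le _ _)
    have hq' := (Finset.mem_filter.1 hq).2
    by_cases h : q.1 = q.2
    · exact Finset.mem_union_right _ (Finset.mem_diag.2 ⟨Finset.mem_univ _, h⟩)
    · refine Finset.mem_union_left _ (Finset.mem_filter.2 ⟨Finset.mem_univ _, h, ?_⟩)
      rw [map_sub, hq', sub_self]
  have h1' : (Fintype.card S : ℝ) ^ 2 ≤
      p * ((Finset.univ.filter fun q : S × S => φ (e q.1) = φ (e q.2)).card : ℝ) := by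
    exact_mod_cast h1
  have h2' : ((Finset.univ.filter fun q : S × S => φ (e q.1) = φ (e q.2)).card : ℝ) ≤
      (Finset.univ.filter fun q : S × S => q.1 ≠ q.2 ∧ φ (e q.1 - e q.2) = 0).card +
        Fintype.card S := by exact_mod_cast h2
  have hp0 : (0 : ℝ) < p := by exact_mod_cast hp.pos
  have : (Fintype.card S : ℝ) ^ 2 / p ≤
      ((Finset.univ.filter fun q : S × S => φ (e q.1) = φ (e q.2)).card : ℝ) := by
    rw [div_le_iff₀ hp0]; linarith
  linarith

-- Double counting of triples (pair, prime, map killing the difference): the norm bounds the total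
-- for each pair from above, coincidences bound it for each map from below.
open Classical in
theorem sum_card_mul_log_mul_le {S : Type*} [Fintype S] {e : S → A}
    (he : Function.Injective e) {L : ℝ} (hL : 0 ≤ L)
    (hN : ∀ s t, s ≠ t → Real.log (Algebra.norm ℤ (e s - e t)).natAbs ≤ L) (x : ℕ)
    (H : ∀ p, Finset (A →+* ZMod p)) :
    ∑ p ∈ Nat.primesLE x, ((H p).card : ℝ) * Real.log p *
      ((Fintype.card S : ℝ) ^ 2 / p - Fintype.card S) ≤ (Fintype.card S : ℝ) ^ 2 * L := by
  let O : Finset (S × S) := Finset.univ.filter fun q => q.1 ≠ q.2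
  have h1 : ∑ q ∈ O, ∑ p ∈ Nat.primesLE x,
      (((H p).filter fun φ => φ (e q.1 - e q.2) = 0).card : ℝ) * Real.log p ≤
      (Fintype.card S : ℝ) ^ 2 * L := by
    calc _ ≤ ∑ q ∈ O, L := Finset.sum_le_sum fun q hq => by
            have hq' : q.1 ≠ q.2 := (Finset.mem_filter.1 hq).2
            exact (sum_card_filter_mul_log_le (sub_ne_zero.2 (he.ne hq')) x H).trans
              (hN _ _ hq')
      _ = (O.card : ℝ) * L := by rw [Finset.sum_const, nsmul_eq_mul]
      _ ≤ _ := by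
        refine mul_le_mul_of_nonneg_right ?_ hL
        have : O.card ≤ Fintype.card S ^ 2 := by
          refine (Finset.card_le_univ _).trans ?_
          rw [Fintype.card_prod, sq]
        exact_mod_cast this
  refine le_trans ?_ h1
  rw [Finset.sum_comm]
  refine Finset.sum_le_sum fun p hp => ?_
  have hp' := (Nat.mem_primesLE.1 hp).2
  have hlog : 0 ≤ Real.log p := Real.log_natCast_nonneg p
  have h2 : ∑ q ∈ O, (((H p).filter fun φ => φ (e q.1 - e q.2) = 0).card : ℝ) =
      ∑ φ ∈ H p, ((Finset.univ.filter fun q : S × S =>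
        q.1 ≠ q.2 ∧ φ (e q.1 - e q.2) = 0).card : ℝ) := by
    simp only [Finset.card_filter, Nat.cast_sum]
    rw [Finset.sum_comm]
    refine Finset.sum_congr rfl fun φ _ => ?_
    rw [Finset.sum_filter]
    refine Finset.sum_congr rfl fun q _ => ?_
    by_cases h : q.1 = q.2 <;> simp [h]
  rw [← Finset.sum_mul, h2, mul_right_comm]
  refine mul_le_mul_of_nonneg_right ?_ hlog
  rw [← nsmul_eq_mul]
  exact Finset.card_nsmul_le_sum _ _ _ fun φ _ => le_card_offDiag_coincidences e hp' φ

/-- The upper bound in Mertens' theorem for the degree one primes of an order. -/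
theorem exists_sum_card_ringHom_mul_log_div_le (K : ℕ) :
    ∃ C : ℝ, 0 ≤ C ∧ ∀ x : ℕ, 1 ≤ x → ∀ H : ∀ p, Finset (A →+* ZMod p),
      (∀ p ∈ Nat.primesLE x, (H p).card ≤ K) →
      ∑ p ∈ Nat.primesLE x, ((H p).card : ℝ) * Real.log p / p ≤ Real.log x + C := by
  classical
  let b := Module.Free.chooseBasis ℤ A
  set ι := Module.Free.ChooseBasisIndex ℤ A
  set n := Fintype.card ι
  have hn : n ≠ 0 := by
    have := b.index_nonempty
    exact Fintype.card_ne_zero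
  obtain ⟨M, hM, hMb⟩ : ∃ M : ℤ, 0 < M ∧ ∀ (a : A) {y : ℤ}, (∀ k, |b.repr a k| ≤ y) →
      |Algebra.norm ℤ a| ≤ M * y ^ n :=
    ⟨_, ClassGroup.normBound_pos AbsoluteValue.abs b,
      fun a _ h => ClassGroup.norm_le AbsoluteValue.abs b a h⟩
  have hM1 : (1 : ℝ) ≤ M := by exact_mod_cast hM
  refine ⟨Real.log M + n * Real.log 2 + K * Real.log 4, ?_, fun x hx H hH => ?_⟩
  · have := Real.log_nonneg hM1
    have := Real.log_nonneg (one_le_two (α := ℝ))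
    have := Real.log_nonneg (show (1 : ℝ) ≤ 4 by norm_num)
    positivity
  -- The box has `T = B ^ n` elements, comparable to `x`: large enough to absorb the diagonal, small
  -- enough that norms stay `O(x)`.
  obtain ⟨B, hB, hxB, hBx⟩ := exists_pow_between hn hx
  let e : (ι → Fin B) → A := fun s => ∑ i, ((s i : ℕ) : ℤ) • b i
  have hrepr : ∀ s i, b.repr (e s) i = ((s i : ℕ) : ℤ) := fun s i => by
    simp only [e]
    rw [b.repr_sum_self]
  have he : Function.Injective e := by
    intro s t hst
    funext i
    have h1 := hrepr s i
    rw [hst, hrepr t i] at h1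
    exact Fin.ext (by exact_mod_cast h1.symm)
  have hcard : Fintype.card (ι → Fin B) = B ^ n := by simp [n]
  have hB1 : (1 : ℝ) ≤ (B : ℝ) ^ n := one_le_pow₀ (by exact_mod_cast hB)
  set L := Real.log (M * (B : ℝ) ^ n)
  have hL : 0 ≤ L := Real.log_nonneg (one_le_mul_of_one_le_of_one_le hM1 hB1)
  have hN : ∀ s t, s ≠ t → Real.log (Algebra.norm ℤ (e s - e t)).natAbs ≤ L := by
    intro s t hst
    have h0 : Algebra.norm ℤ (e s - e t) ≠ 0 :=
      Algebra.norm_ne_zero_iff.2 (sub_ne_zero.2 (he.ne hst))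
    have h1 := hMb (e s - e t) (y := B) (fun k => by
      rw [map_sub, Finsupp.sub_apply, hrepr, hrepr, abs_le]
      have := (s k).2
      have := (t k).2
      constructor <;> omega)
    refine Real.log_le_log (by exact_mod_cast Int.natAbs_pos.2 h0) ?_
    rw [Nat.cast_natAbs]
    exact_mod_cast h1
  have hmain := sum_card_mul_log_mul_le he hL hN x H
  rw [hcard, Nat.cast_pow] at hmain
  have hxT : (x : ℝ) ≤ (B : ℝ) ^ n := by exact_mod_cast hxB
  have hTx : (B : ℝ) ^ n ≤ 2 ^ n * x := by exact_mod_cast hBx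
  set T : ℝ := (B : ℝ) ^ n
  have hT : (0 : ℝ) < T := by linarith
  have hθ : ∑ p ∈ Nat.primesLE x, Real.log p ≤ Real.log 4 * x := by
    rw [← Chebyshev.theta_eq_sum_primesLE_log]
    exact Chebyshev.theta_le_log4_mul_x (Nat.cast_nonneg x)
  have hKθ : ∑ p ∈ Nat.primesLE x, ((H p).card : ℝ) * Real.log p ≤ K * (Real.log 4 * x) := by
    calc _ ≤ ∑ p ∈ Nat.primesLE x, (K : ℝ) * Real.log p :=
          Finset.sum_le_sum fun p hp => mul_le_mul_of_nonneg_right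
            (by exact_mod_cast hH p hp) (Real.log_natCast_nonneg p)
      _ ≤ _ := by
        rw [← Finset.mul_sum]
        exact mul_le_mul_of_nonneg_left hθ (Nat.cast_nonneg K)
  have hsplit : ∑ p ∈ Nat.primesLE x, ((H p).card : ℝ) * Real.log p * (T ^ 2 / p - T) =
      T ^ 2 * (∑ p ∈ Nat.primesLE x, ((H p).card : ℝ) * Real.log p / p) -
        T * ∑ p ∈ Nat.primesLE x, ((H p).card : ℝ) * Real.log p := by
    rw [Finset.mul_sum, Finset.mul_sum, ← Finset.sum_sub_distrib]
    exact Finset.sum_congr rfl fun p _ => by ring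
  rw [hsplit] at hmain
  have hx0 : (0 : ℝ) < x := by exact_mod_cast hx
  have hlogT : Real.log T ≤ n * Real.log 2 + Real.log x := by
    rw [← Real.log_pow, ← Real.log_mul (by positivity) hx0.ne']
    exact Real.log_le_log hT hTx
  have hLe : L = Real.log M + Real.log T := Real.log_mul (by positivity) hT.ne'
  have h4 : 0 ≤ Real.log 4 := Real.log_nonneg (by norm_num)
  -- The diagonal costs `T` times a Chebyshev sum of size `O(x)`, and `x ≤ T` makes this `O(T ^ 2)`.
  have hfin : T ^ 2 * (∑ p ∈ Nat.primesLE x, ((H p).card : ℝ) * Real.log p / p) ≤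
      T ^ 2 * (L + K * Real.log 4) := by
    have : T * ∑ p ∈ Nat.primesLE x, ((H p).card : ℝ) * Real.log p ≤
        T * (K * (Real.log 4 * T)) := by
      refine mul_le_mul_of_nonneg_left (hKθ.trans ?_) hT.le
      gcongr
    nlinarith
  have := le_of_mul_le_mul_left hfin (by positivity)
  linarith

end Averaging

/-! ### Roots of `f` modulo primes. -/

/-- The roots of `f` modulo `m`, as natural numbers below `m`. -/
def rootsMod (f : ℤ[X]) (m : ℕ) : Finset ℕ :=
  (Finset.range m).filter fun a => (m : ℤ) ∣ f.eval (a : ℤ)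

theorem eval₂_zmod_eq_zero_iff_dvd (f : ℤ[X]) (m : ℕ) (a : ℤ) :
    f.eval₂ (Int.castRingHom (ZMod m)) (a : ZMod m) = 0 ↔ (m : ℤ) ∣ f.eval a := by
  rw [← ZMod.intCast_zmod_eq_zero_iff_dvd, ← eq_intCast (Int.castRingHom (ZMod m)) a,
    eval₂_hom, eq_intCast]

theorem card_rootsMod_le {f : ℤ[X]} (hf : f.Monic) {p : ℕ} (hp : p.Prime) :
    (rootsMod f p).card ≤ f.natDegree := by
  classical
  have : Fact p.Prime := ⟨hp⟩
  have h1 : (rootsMod f p).image (fun a : ℕ => (a : ZMod p)) ⊆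
      (f.map (Int.castRingHom (ZMod p))).roots.toFinset := by
    intro z hz
    obtain ⟨a, ha, rfl⟩ := Finset.mem_image.1 hz
    rw [Multiset.mem_toFinset, mem_roots (hf.map _).ne_zero, IsRoot, eval_map]
    have := (eval₂_zmod_eq_zero_iff_dvd f p a).2 (Finset.mem_filter.1 ha).2
    simpa using this
  have h2 : ((rootsMod f p).image (fun a : ℕ => (a : ZMod p))).card = (rootsMod f p).card := by
    refine Finset.card_image_of_injOn fun a ha b hb hab => ?_
    have ha' := Finset.mem_range.1 (Finset.mem_filter.1 ha).1
    have hb' := Finset.mem_range.1 (Finset.mem_filter.1 hb).1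
    have := (ZMod.natCast_eq_natCast_iff' _ _ _).1 hab
    rwa [Nat.mod_eq_of_lt ha', Nat.mod_eq_of_lt hb'] at this
  rw [← h2]
  refine (Finset.card_le_card h1).trans ((Multiset.toFinset_card_le _).trans ?_)
  exact (card_roots' _).trans natDegree_map_le

/-- Nagell's estimate for the number of roots of an irreducible polynomial modulo primes. -/
theorem exists_sum_card_rootsMod_mul_log_div_le {f : ℤ[X]} (hf : f.Monic)
    (hirr : Irreducible f) :
    ∃ C : ℝ, 0 ≤ C ∧ ∀ x : ℕ, 1 ≤ x →
      ∑ p ∈ Nat.primesLE x, ((rootsMod f p).card : ℝ) * Real.log p / p ≤ Real.log x + C := by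
  classical
  have : IsDomain (AdjoinRoot f) := AdjoinRoot.isDomain_of_prime hirr.prime
  have : Module.Free ℤ (AdjoinRoot f) := .of_basis (AdjoinRoot.powerBasis' hf).basis
  have : Module.Finite ℤ (AdjoinRoot f) := .of_basis (AdjoinRoot.powerBasis' hf).basis
  obtain ⟨C, hC0, hC⟩ := exists_sum_card_ringHom_mul_log_div_le (A := AdjoinRoot f) f.natDegree
  refine ⟨C, hC0, fun x hx => ?_⟩
  have hroot : ∀ p, ∀ a : rootsMod f p,
      f.eval₂ (Int.castRingHom (ZMod p)) ((a : ℕ) : ZMod p) = 0 := fun p a => by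
    have := (eval₂_zmod_eq_zero_iff_dvd f p (a : ℕ)).2 (Finset.mem_filter.1 a.2).2
    simpa using this
  -- A root modulo `p` is the image of the adjoined root under a ring map to `ZMod p`.
  let ev : ∀ p, rootsMod f p → (AdjoinRoot f →+* ZMod p) := fun p a =>
    AdjoinRoot.lift (Int.castRingHom (ZMod p)) ((a : ℕ) : ZMod p) (hroot p a)
  have hev : ∀ p, Function.Injective (ev p) := by
    intro p a b hab
    have h1 : ev p a (AdjoinRoot.root f) = ev p b (AdjoinRoot.root f) := by rw [hab]
    simp only [ev, AdjoinRoot.lift_root] at h1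
    have ha' := Finset.mem_range.1 (Finset.mem_filter.1 a.2).1
    have hb' := Finset.mem_range.1 (Finset.mem_filter.1 b.2).1
    have := (ZMod.natCast_eq_natCast_iff' _ _ _).1 h1
    rw [Nat.mod_eq_of_lt ha', Nat.mod_eq_of_lt hb'] at this
    exact Subtype.ext this
  have hcard : ∀ p, (Finset.univ.image (ev p)).card = (rootsMod f p).card := fun p => by
    rw [Finset.card_image_of_injective _ (hev p), Finset.card_univ, Fintype.card_coe]
  have := hC x hx (fun p => Finset.univ.image (ev p)) (fun p hp => by
    rw [hcard]; exact card_rootsMod_le hf (Nat.mem_primesLE.1 hp).2)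
  simpa only [hcard] using this

/-! ### Valuations of the values of `f` at a fixed prime. -/

theorem eval_ne_zero_of_irreducible {f : ℤ[X]} (hirr : Irreducible f) (hdeg : 2 ≤ f.natDegree)
    (n : ℤ) : f.eval n ≠ 0 := by
  intro h
  obtain ⟨g, hg⟩ := dvd_iff_isRoot.2 h
  have hX : ¬ IsUnit (X - C n : ℤ[X]) := not_isUnit_X_sub_C n
  have hu := (hirr.isUnit_or_isUnit hg).resolve_left hX
  have hg0 : g ≠ 0 := hu.ne_zero
  have h1 : f.natDegree = 1 := by
    rw [hg, natDegree_mul (X_sub_C_ne_zero n) hg0, natDegree_X_sub_C,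
      natDegree_eq_zero_of_isUnit hu]
  omega

/-- Common divisors of the values of `f` and `f'` divide a fixed nonzero integer. -/
theorem exists_dvd_of_dvd_eval_of_dvd_eval_derivative {f : ℤ[X]} (hf : f.Monic)
    (hirr : Irreducible f) (hdeg : 2 ≤ f.natDegree) :
    ∃ Δ : ℕ, Δ ≠ 0 ∧ ∀ n m : ℤ, m ∣ f.eval n → m ∣ f.derivative.eval n → m ∣ Δ := by
  have : IsDomain (AdjoinRoot f) := AdjoinRoot.isDomain_of_prime hirr.prime
  have : Module.Free ℤ (AdjoinRoot f) := .of_basis (AdjoinRoot.powerBasis' hf).basis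
  have : Module.Finite ℤ (AdjoinRoot f) := .of_basis (AdjoinRoot.powerBasis' hf).basis
  have hd0 : f.derivative ≠ 0 := fun h => by
    have := derivative_eq_zero.1 h
    omega
  have hβ : AdjoinRoot.mk f f.derivative ≠ 0 := by
    rw [Ne, AdjoinRoot.mk_eq_zero]
    intro h
    have h1 := natDegree_le_of_dvd h hd0
    have h2 := natDegree_derivative_lt (p := f) (by omega)
    omega
  -- The index `k` of the ideal generated by `f'` kills the quotient, so `k = f u + f' v` in `ℤ[X]`.
  obtain ⟨k, hk⟩ : ∃ k, k = Nat.card (AdjoinRoot f ⧸ Ideal.span {AdjoinRoot.mk f f.derivative}) :=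
    ⟨_, rfl⟩
  refine ⟨k, ?_, fun n m h1 h2 => ?_⟩
  · rw [hk, ← natAbs_norm_eq_card_quotient_span hβ]
    exact Int.natAbs_ne_zero.2 (Algebra.norm_ne_zero_iff.2 hβ)
  have h3 : k • (1 : AdjoinRoot f ⧸ Ideal.span {AdjoinRoot.mk f f.derivative}) = 0 := by
    rw [hk]; exact card_nsmul_eq_zero'
  have h4 : (Ideal.Quotient.mk (Ideal.span {AdjoinRoot.mk f f.derivative}))
      (AdjoinRoot.mk f (k : ℤ[X])) = 0 := by
    rw [map_natCast, map_natCast, ← nsmul_one, h3]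
  rw [Ideal.Quotient.eq_zero_iff_mem, Ideal.mem_span_singleton] at h4
  obtain ⟨c, hc⟩ := h4
  obtain ⟨v, rfl⟩ := AdjoinRoot.mk_surjective c
  rw [← map_mul, AdjoinRoot.mk_eq_mk] at hc
  obtain ⟨u, hu⟩ := hc
  have h5 : (k : ℤ) = f.eval n * u.eval n + f.derivative.eval n * v.eval n := by
    have := congrArg (eval n) hu
    simp only [eval_sub, eval_mul, eval_natCast] at this
    linarith
  rw [h5]
  exact dvd_add (h1.mul_right _) (h2.mul_right _)

/-- Two nearby arguments at which `f` is divisible by `p ^ k` are close `p`-adically. -/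
theorem pow_dvd_pow_mul_sub {f : ℤ[X]} {Δ : ℕ} (hΔ0 : Δ ≠ 0)
    (hΔ : ∀ n m : ℤ, m ∣ f.eval n → m ∣ f.derivative.eval n → m ∣ Δ) {p : ℕ} (hp : p.Prime)
    {k : ℕ} {n m : ℤ} (hn : (p : ℤ) ^ k ∣ f.eval n) (hm : (p : ℤ) ^ k ∣ f.eval m)
    (hnm : (p : ℤ) ^ (Δ.factorization p + 1) ∣ m - n) :
    (p : ℤ) ^ k ∣ (p : ℤ) ^ Δ.factorization p * (m - n) := by
  set δ := Δ.factorization p with hδ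
  rcases le_or_gt k δ with hk | hk
  · exact (pow_dvd_pow _ hk).mul_right _
  have hpZ : Prime (p : ℤ) := Nat.prime_iff_prime_int.1 hp
  -- Write `f m - f n = (m - n) z` with `z ≡ f' n` modulo `m - n`. Then `p ^ (δ + 1)` cannot divide
  -- `z`, or it would divide `Δ`.
  obtain ⟨w, hw⟩ := f.binomExpansion n (m - n)
  rw [add_sub_cancel] at hw
  set z := f.derivative.eval n + w * (m - n) with hz
  have h1 : (p : ℤ) ^ k ∣ (m - n) * z := by
    have : (m - n) * z = f.eval m - f.eval n := by rw [hw, hz]; ring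
    rw [this]; exact dvd_sub hm hn
  have h2 : ¬ (p : ℤ) ^ (δ + 1) ∣ z := by
    intro h
    have h3 : (p : ℤ) ^ (δ + 1) ∣ f.derivative.eval n := by
      have : f.derivative.eval n = z - w * (m - n) := by rw [hz]; ring
      rw [this]; exact dvd_sub h (hnm.mul_left _)
    have h4 := hΔ n _ ((pow_dvd_pow _ hk).trans hn) h3
    have h5 : p ^ (δ + 1) ∣ Δ := by exact_mod_cast h4
    rw [hp.pow_dvd_iff_le_factorization hΔ0] at h5
    omega
  have hz0 : z ≠ 0 := fun h => h2 (h ▸ dvd_zero _)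
  obtain ⟨j, z', hz', hzj⟩ := WfDvdMonoid.max_power_factor hz0 hpZ.irreducible
  have hj : j ≤ δ := by
    by_contra hj
    exact h2 ((pow_dvd_pow _ (by omega)).trans (hzj ▸ dvd_mul_right _ _))
  have hco : IsCoprime ((p : ℤ) ^ k) z' :=
    IsCoprime.pow_left ((Prime.coprime_iff_not_dvd hpZ).2 hz')
  rw [hzj, ← mul_assoc] at h1
  have h6 := hco.dvd_of_dvd_mul_right h1
  rw [mul_comm]
  exact h6.trans (mul_dvd_mul_left _ (pow_dvd_pow _ hj))

theorem sum_Ico_factorization (p m : ℕ) :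
    ∑ j ∈ Finset.Ico 1 (m + 1), j.factorization p = (m.factorial).factorization p := by
  induction m with
  | zero => simp
  | succ m ih =>
    rw [Finset.sum_Ico_succ_top (by omega), ih, Nat.factorial_succ,
      Nat.factorization_mul (by omega) (Nat.factorial_ne_zero m), Finsupp.add_apply, add_comm]

/-- With `n₀ = a + 1` and `N = a + 1 + b`, the distances to `n₀` run through `1..a` and `1..b`, and
`a! b!` divides `N!`. -/
theorem sum_erase_factorization_le {N n₀ : ℕ} (p : ℕ) (h : n₀ ∈ Finset.Icc 1 N) :
    ∑ n ∈ (Finset.Icc 1 N).erase n₀, ((n : ℤ) - n₀).natAbs.factorization p ≤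
      (N.factorial).factorization p := by
  obtain ⟨h1, h2⟩ := Finset.mem_Icc.1 h
  obtain ⟨a, rfl⟩ : ∃ a, n₀ = a + 1 := ⟨n₀ - 1, by omega⟩
  obtain ⟨b, rfl⟩ : ∃ b, N = a + 1 + b := ⟨N - (a + 1), by omega⟩
  have hsplit : (Finset.Icc 1 (a + 1 + b)).erase (a + 1) =
      (Finset.Ico 1 (a + 1)).image (fun j => a + 1 - j) ∪
        (Finset.Ico 1 (b + 1)).image (fun j => a + 1 + j) := by
    ext n
    simp only [Finset.mem_erase, Finset.mem_Icc, Finset.mem_union, Finset.mem_image,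
      Finset.mem_Ico]
    constructor
    · rintro ⟨h3, h4, h5⟩
      rcases lt_or_gt_of_ne h3 with h6 | h6
      · exact Or.inl ⟨a + 1 - n, by omega, by omega⟩
      · exact Or.inr ⟨n - (a + 1), by omega, by omega⟩
    · rintro (⟨j, h3, rfl⟩ | ⟨j, h3, rfl⟩) <;> omega
  have hdisj : Disjoint ((Finset.Ico 1 (a + 1)).image (fun j => a + 1 - j))
      ((Finset.Ico 1 (b + 1)).image (fun j => a + 1 + j)) := by
    rw [Finset.disjoint_left]
    intro n h3 h4
    obtain ⟨j, -, rfl⟩ := Finset.mem_image.1 h3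
    obtain ⟨i, hi, h5⟩ := Finset.mem_image.1 h4
    rw [Finset.mem_Ico] at hi
    omega
  rw [hsplit, Finset.sum_union hdisj, Finset.sum_image (fun i hi j hj hij => by
      have := Finset.mem_Ico.1 hi
      have := Finset.mem_Ico.1 hj
      omega), Finset.sum_image (fun i _ j _ hij => by simpa using hij)]
  have e1 : ∀ j ∈ Finset.Ico 1 (a + 1),
      (((a + 1 - j : ℕ) : ℤ) - ((a + 1 : ℕ) : ℤ)).natAbs.factorization p =
        j.factorization p := fun j hj => by
    rw [Finset.mem_Ico] at hj
    congr 2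
    omega
  have e2 : ∀ j ∈ Finset.Ico 1 (b + 1),
      (((a + 1 + j : ℕ) : ℤ) - ((a + 1 : ℕ) : ℤ)).natAbs.factorization p =
        j.factorization p := fun j hj => by
    congr 2
    omega
  rw [Finset.sum_congr rfl e1, Finset.sum_congr rfl e2, sum_Ico_factorization,
    sum_Ico_factorization, ← Finsupp.add_apply, ← Nat.factorization_mul
      (Nat.factorial_ne_zero a) (Nat.factorial_ne_zero b)]
  have hdvd : a.factorial * b.factorial ∣ (a + 1 + b).factorial :=
    (Nat.factorial_mul_factorial_dvd_factorial_add a b).trans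
      (Nat.factorial_dvd_factorial (by omega))
  exact (Nat.factorization_le_iff_dvd (by positivity) (Nat.factorial_ne_zero _)).2 hdvd p

theorem factorization_factorial_mul_log_le {p : ℕ} (hp : p.Prime) (N : ℕ) :
    ((N.factorial).factorization p : ℝ) * Real.log p ≤ N * (Real.log p / ((p : ℝ) - 1)) := by
  have : Fact p.Prime := ⟨hp⟩
  have h1 := sub_one_mul_padicValNat_factorial (p := p) N
  rw [← Nat.factorization_def _ hp] at h1
  have h2 : (p - 1) * (N.factorial).factorization p ≤ N := by omega
  have h3 : ((p : ℝ) - 1) * (N.factorial).factorization p ≤ N := by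
    rw [← Nat.cast_one, ← Nat.cast_sub hp.one_le]
    exact_mod_cast h2
  have hp1 : (0 : ℝ) < (p : ℝ) - 1 := by
    have : (1 : ℝ) < p := by exact_mod_cast hp.one_lt
    linarith
  rw [mul_div_assoc', le_div_iff₀ hp1]
  have := mul_le_mul_of_nonneg_right h3 (Real.log_natCast_nonneg p)
  linarith

/-- The sum of the valuations of the values of `f` over a residue class. -/
theorem sum_factorization_eval_mul_log_le {f : ℤ[X]} (h0 : ∀ n : ℤ, f.eval n ≠ 0) {Δ : ℕ}
    (hΔ0 : Δ ≠ 0) (hΔ : ∀ n m : ℤ, m ∣ f.eval n → m ∣ f.derivative.eval n → m ∣ Δ) {p : ℕ}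
    (hp : p.Prime) {N : ℕ} {L : ℝ} (hL0 : 0 ≤ L)
    (hL : ∀ n ∈ Finset.Icc 1 N, Real.log (f.eval (n : ℤ)).natAbs ≤ L) {S : Finset ℕ}
    (hS : S ⊆ Finset.Icc 1 N)
    (hmod : ∀ n ∈ S, ∀ m ∈ S, n % p ^ (Δ.factorization p + 1) = m % p ^ (Δ.factorization p + 1)) :
    ((∑ n ∈ S, (f.eval (n : ℤ)).natAbs.factorization p : ℕ) : ℝ) * Real.log p ≤
      L + N * (Δ.factorization p * Real.log p + Real.log p / ((p : ℝ) - 1)) := by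
  have hlog := Real.log_natCast_nonneg p
  have hp1 : (0 : ℝ) < (p : ℝ) - 1 := by
    have : (1 : ℝ) < p := by exact_mod_cast hp.one_lt
    linarith
  rcases S.eq_empty_or_nonempty with rfl | hne
  · simp only [Finset.sum_empty, Nat.cast_zero, zero_mul]
    positivity
  -- At an `n₀` of maximal valuation only the size bound `L` is used; every other valuation is at
  -- most `δ` plus that of `n - n₀`.
  obtain ⟨n₀, hn₀, hmax⟩ :=
    S.exists_max_image (fun n => (f.eval (n : ℤ)).natAbs.factorization p) hne
  set δ := Δ.factorization p with hδ
  have hstep : ∀ n ∈ S.erase n₀, (f.eval (n : ℤ)).natAbs.factorization p ≤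
      δ + ((n : ℤ) - n₀).natAbs.factorization p := by
    intro n hn
    obtain ⟨hne', hnS⟩ := Finset.mem_erase.1 hn
    have hpow : ∀ (a : ℤ) (k : ℕ), (p : ℤ) ^ k ∣ a ↔ p ^ k ∣ a.natAbs := fun a k => by
      rw [← Int.natCast_dvd, Nat.cast_pow]
    have hdvd : ∀ (m : ℕ) (k : ℕ), (p : ℤ) ^ k ∣ f.eval (m : ℤ) ↔
        k ≤ (f.eval (m : ℤ)).natAbs.factorization p := fun m k => by
      rw [hpow, hp.pow_dvd_iff_le_factorization (Int.natAbs_ne_zero.2 (h0 _))]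
    have h1 := pow_dvd_pow_mul_sub hΔ0 hΔ hp (k := (f.eval (n : ℤ)).natAbs.factorization p)
      (n := n₀) (m := n) ((hdvd _ _).2 (hmax n hnS)) ((hdvd _ _).2 le_rfl) (by
        have := (Nat.modEq_iff_dvd (n := p ^ (δ + 1))).1 (hmod n₀ hn₀ n hnS)
        rwa [Nat.cast_pow] at this)
    have h2 : (n : ℤ) - n₀ ≠ 0 := by
      intro h; exact hne' (by omega)
    rw [hpow, hp.pow_dvd_iff_le_factorization (Int.natAbs_ne_zero.2 (mul_ne_zero
      (pow_ne_zero _ (by exact_mod_cast hp.ne_zero)) h2)), Int.natAbs_mul, Int.natAbs_pow,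
      Int.natAbs_natCast, Nat.factorization_mul (pow_ne_zero _ hp.ne_zero)
      (Int.natAbs_ne_zero.2 h2), Finsupp.add_apply, hp.factorization_pow,
      Finsupp.single_eq_same] at h1
    exact h1
  have hmem := hS hn₀
  have h1 : ∑ n ∈ S.erase n₀, (f.eval (n : ℤ)).natAbs.factorization p ≤
      N * δ + (N.factorial).factorization p := by
    refine (Finset.sum_le_sum hstep).trans ?_
    rw [Finset.sum_add_distrib, Finset.sum_const, smul_eq_mul]
    refine add_le_add (Nat.mul_le_mul_right _ ?_) ?_
    · calc (S.erase n₀).card ≤ S.card := Finset.card_le_card (Finset.erase_subset _ _)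
        _ ≤ (Finset.Icc 1 N).card := Finset.card_le_card hS
        _ = N := by simp
    · exact (Finset.sum_le_sum_of_subset (Finset.erase_subset_erase _ hS)).trans
        (sum_erase_factorization_le p hmem)
  have h2 : ((f.eval (n₀ : ℤ)).natAbs.factorization p : ℝ) * Real.log p ≤ L := by
    refine le_trans ?_ (hL n₀ hmem)
    rw [← Real.log_pow]
    have hne0 := Int.natAbs_ne_zero.2 (h0 n₀)
    refine Real.log_le_log (pow_pos (by exact_mod_cast hp.pos) _) ?_
    exact_mod_cast Nat.le_of_dvd (Nat.pos_of_ne_zero hne0) (Nat.ordProj_dvd _ p)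
  have h3 := factorization_factorial_mul_log_le hp N
  have h4 : ((∑ n ∈ S.erase n₀, (f.eval (n : ℤ)).natAbs.factorization p : ℕ) : ℝ) ≤
      N * δ + (N.factorial).factorization p := by exact_mod_cast h1
  rw [← Finset.add_sum_erase S _ hn₀, Nat.cast_add, add_mul]
  have h5 := mul_le_mul_of_nonneg_right h4 hlog
  nlinarith

theorem factorization_Qf {f : ℤ[X]} (h0 : ∀ n : ℤ, f.eval n ≠ 0) (N p : ℕ) :
    (Qf f N).factorization p =
      ∑ n ∈ Finset.Icc 1 N, (f.eval (n : ℤ)).natAbs.factorization p := by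
  have hQ : Qf f N = ∏ n ∈ Finset.Icc 1 N, (f.eval (n : ℤ)).natAbs :=
    map_prod Int.natAbsHom _ _
  rw [hQ, Nat.factorization_prod (fun n _ => Int.natAbs_ne_zero.2 (h0 _)), Finset.sum_apply']

/-- Sum over the residue classes in `R`. It will be the roots modulo `p` when `p ∤ Δ`, and all
residues for the finitely many other primes. -/
theorem factorization_Qf_mul_log_le {f : ℤ[X]} (h0 : ∀ n : ℤ, f.eval n ≠ 0) {Δ : ℕ}
    (hΔ0 : Δ ≠ 0) (hΔ : ∀ n m : ℤ, m ∣ f.eval n → m ∣ f.derivative.eval n → m ∣ Δ) {p : ℕ}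
    (hp : p.Prime) {N : ℕ} {L : ℝ} (hL0 : 0 ≤ L)
    (hL : ∀ n ∈ Finset.Icc 1 N, Real.log (f.eval (n : ℤ)).natAbs ≤ L) {R : Finset ℕ}
    (hR : ∀ n ∈ Finset.Icc 1 N, p ∣ (f.eval (n : ℤ)).natAbs →
      n % p ^ (Δ.factorization p + 1) ∈ R) :
    ((Qf f N).factorization p : ℝ) * Real.log p ≤
      R.card * (L + N * (Δ.factorization p * Real.log p + Real.log p / ((p : ℝ) - 1))) := by
  classical
  rw [factorization_Qf h0]
  set M := p ^ (Δ.factorization p + 1)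
  have h1 : ∑ n ∈ Finset.Icc 1 N, (f.eval (n : ℤ)).natAbs.factorization p =
      ∑ r ∈ R, ∑ n ∈ ((Finset.Icc 1 N).filter fun n : ℕ => p ∣ (f.eval (n : ℤ)).natAbs).filter
        (fun n => n % M = r), (f.eval (n : ℤ)).natAbs.factorization p := by
    rw [Finset.sum_fiberwise_of_maps_to (fun n hn => by
      rw [Finset.mem_filter] at hn; exact hR n hn.1 hn.2), Finset.sum_filter_of_ne]
    intro n _ hn
    by_contra h
    exact hn (Nat.factorization_eq_zero_of_not_dvd h)
  rw [h1, Nat.cast_sum, Finset.sum_mul, ← nsmul_eq_mul]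
  refine Finset.sum_le_card_nsmul _ _ _ fun r _ => ?_
  refine sum_factorization_eval_mul_log_le h0 hΔ0 hΔ hp hL0 hL ?_ ?_
  · exact (Finset.filter_subset _ _).trans (Finset.filter_subset _ _)
  · intro n hn m hm
    exact (Finset.mem_filter.1 hn).2.trans (Finset.mem_filter.1 hm).2.symm

/-! ### Total contribution of the small primes. -/

theorem natAbs_eval_le (f : ℤ[X]) {n N : ℕ} (hn : n ≤ N) (hN : 1 ≤ N) :
    ((f.eval (n : ℤ)).natAbs : ℝ) ≤
      (1 + ∑ i ∈ Finset.range (f.natDegree + 1), |(f.coeff i : ℝ)|) * (N : ℝ) ^ f.natDegree := by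
  rw [Nat.cast_natAbs, Int.cast_abs, eval_eq_sum_range, Int.cast_sum]
  have hN' : (1 : ℝ) ≤ N := by exact_mod_cast hN
  have hn' : (n : ℝ) ≤ N := by exact_mod_cast hn
  calc _ ≤ ∑ i ∈ Finset.range (f.natDegree + 1), |((f.coeff i * (n : ℤ) ^ i : ℤ) : ℝ)| :=
        Finset.abs_sum_le_sum_abs _ _
    _ ≤ ∑ i ∈ Finset.range (f.natDegree + 1), |(f.coeff i : ℝ)| * (N : ℝ) ^ f.natDegree := by
        refine Finset.sum_le_sum fun i hi => ?_
        rw [Int.cast_mul, abs_mul, Int.cast_pow, Int.cast_natCast,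
          abs_of_nonneg (a := (n : ℝ) ^ i) (by positivity)]
        refine mul_le_mul_of_nonneg_left ?_ (abs_nonneg _)
        calc (n : ℝ) ^ i ≤ (N : ℝ) ^ i := pow_le_pow_left₀ (Nat.cast_nonneg n) hn' i
          _ ≤ _ := pow_le_pow_right₀ hN' (by rw [Finset.mem_range] at hi; omega)
    _ ≤ _ := by
        rw [← Finset.sum_mul]
        refine mul_le_mul_of_nonneg_right ?_ (by positivity)
        linarith

/-- Chebyshev's bound, with the error `√T log T` absorbed by `log T ≤ 2 √T`. -/
theorem primeCounting_mul_log_le {T : ℕ} (hT : 1 ≤ T) :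
    ((Nat.primesLE T).card : ℝ) * Real.log T ≤ (2 * Real.log 4 + 2) * T := by
  have h4 : 0 ≤ Real.log 4 := Real.log_nonneg (by norm_num)
  rcases hT.eq_or_lt with rfl | hT
  · simp; positivity
  have hx : (1 : ℝ) < T := by exact_mod_cast hT
  have h := Chebyshev.pi_le_log4_mul_div hx
  rw [Nat.floor_natCast] at h
  have hcard : (Nat.primesLE T).card = Nat.primeCounting T := by simp
  rw [hcard]
  generalize (T : ℝ) = x at *
  have hlx : 0 < Real.log x := Real.log_pos hx
  have hs : Real.log √x = Real.log x / 2 := Real.log_sqrt (by linarith)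
  rw [hs] at h
  have h1 := mul_le_mul_of_nonneg_right h hlx.le
  have h2 : (Real.log 4 * x / (Real.log x / 2) + √x) * Real.log x =
      2 * Real.log 4 * x + √x * Real.log x := by
    field_simp
  rw [h2] at h1
  have h3 : Real.log x ≤ 2 * √x := by
    have := Real.log_le_self (Real.sqrt_nonneg x)
    linarith
  have h5 : √x * √x = x := Real.mul_self_sqrt (by linarith)
  have h6 := mul_le_mul_of_nonneg_left h3 (Real.sqrt_nonneg x)
  nlinarith

/-- Comparison with `4 n^(-3/2)`, from `log p ≤ 2 √p` and `p - 1 ≥ p / 2`. -/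
theorem exists_sum_log_div_mul_sub_one_le :
    ∃ C : ℝ, 0 ≤ C ∧ ∀ x : ℕ,
      ∑ p ∈ Nat.primesLE x, Real.log p / ((p : ℝ) * ((p : ℝ) - 1)) ≤ C := by
  have hs : Summable fun n : ℕ => 4 * (1 / (n : ℝ) ^ (3 / 2 : ℝ)) :=
    (Real.summable_one_div_nat_rpow.2 (by norm_num)).mul_left 4
  refine ⟨∑' n : ℕ, 4 * (1 / (n : ℝ) ^ (3 / 2 : ℝ)), tsum_nonneg fun n => by positivity,
    fun x => ?_⟩
  refine le_trans (Finset.sum_le_sum fun p hp => ?_)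
    (hs.sum_le_tsum (Nat.primesLE x) fun n _ => by positivity)
  have hp' := (Nat.mem_primesLE.1 hp).2
  have h2 : (2 : ℝ) ≤ p := by exact_mod_cast hp'.two_le
  have h0 : (0 : ℝ) < p := by linarith
  have hl : Real.log p ≤ 2 * √p := by
    have := Real.log_le_self (Real.sqrt_nonneg p)
    rw [Real.log_sqrt h0.le] at this
    linarith
  have hr : (p : ℝ) ^ (3 / 2 : ℝ) = p * √p := by
    rw [Real.sqrt_eq_rpow, show (3 / 2 : ℝ) = 1 + 1 / 2 by norm_num, Real.rpow_add h0,
      Real.rpow_one]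
  have hsq : √(p : ℝ) * √p = p := Real.mul_self_sqrt h0.le
  have hs0 : 0 < √(p : ℝ) := Real.sqrt_pos.2 h0
  rw [hr, mul_one_div, div_le_div_iff₀ (by nlinarith) (by positivity)]
  calc Real.log p * (p * √p) ≤ 2 * √p * (p * √p) := by gcongr
    _ = 2 * p * p := by linear_combination 2 * (p : ℝ) * hsq
    _ ≤ 4 * (p * (p - 1)) := by nlinarith

/-- The contribution of the primes up to `c * N` to `log Q_f(N)` is at most `N log N + O(N)`. -/
theorem exists_sum_factorization_Qf_mul_log_le {f : ℤ[X]} (hf : f.Monic) (hirr : Irreducible f)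
    (hdeg : 2 ≤ f.natDegree) {c : ℕ} (hc : 1 ≤ c) :
    ∃ C : ℝ, ∀ N : ℕ, 1 ≤ N →
      ∑ p ∈ Nat.primesLE (c * N), ((Qf f N).factorization p : ℝ) * Real.log p ≤
        N * Real.log N + C * N := by
  have h0 := eval_ne_zero_of_irreducible hirr hdeg
  obtain ⟨Δ, hΔ0, hΔ⟩ := exists_dvd_of_dvd_eval_of_dvd_eval_derivative hf hirr hdeg
  obtain ⟨C₁, hC₁, hM⟩ := exists_sum_card_rootsMod_mul_log_div_le hf hirr
  obtain ⟨C₂, hC₂, hS⟩ := exists_sum_log_div_mul_sub_one_le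
  set d := f.natDegree
  set a : ℝ := 1 + ∑ i ∈ Finset.range (d + 1), |(f.coeff i : ℝ)|
  have ha : 1 ≤ a := le_add_of_nonneg_right (Finset.sum_nonneg fun _ _ => abs_nonneg _)
  have hla : 0 ≤ Real.log a := Real.log_nonneg ha
  -- `W p * N` bounds the contribution of a prime dividing `Δ`, all residue classes included.
  let W : ℕ → ℝ := fun p => (p : ℝ) ^ (Δ.factorization p + 1) *
    (Real.log a + d + (Δ.factorization p * Real.log p + Real.log p / ((p : ℝ) - 1)))
  have hW : ∀ p, p.Prime → 0 ≤ W p := fun p hp => by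
    have := Real.log_natCast_nonneg p
    have : (0 : ℝ) < (p : ℝ) - 1 := by
      have : (1 : ℝ) < p := by exact_mod_cast hp.one_lt
      linarith
    positivity
  refine ⟨d * (Real.log a + d * (2 * Real.log 4 + 2)) * c + (Real.log c + C₁) + d * C₂ +
    ∑ p ∈ Δ.primeFactors, W p, fun N hN => ?_⟩
  have hN1 : (1 : ℝ) ≤ N := by exact_mod_cast hN
  have hc1 : (1 : ℝ) ≤ c := by exact_mod_cast hc
  have hlN : 0 ≤ Real.log N := Real.log_natCast_nonneg N
  set L := Real.log a + d * Real.log N with hLdef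
  have hL0 : 0 ≤ L := by positivity
  have hL : ∀ n ∈ Finset.Icc 1 N, Real.log (f.eval (n : ℤ)).natAbs ≤ L := fun n hn => by
    have h1 := natAbs_eval_le f (Finset.mem_Icc.1 hn).2 hN
    have h2 : (0 : ℝ) < (f.eval (n : ℤ)).natAbs := by
      exact_mod_cast Int.natAbs_pos.2 (h0 n)
    refine (Real.log_le_log h2 h1).trans_eq ?_
    rw [Real.log_mul (by linarith) (by positivity), Real.log_pow]
  have hpt : ∀ p ∈ Nat.primesLE (c * N), ((Qf f N).factorization p : ℝ) * Real.log p ≤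
      (d * L + N * ((rootsMod f p).card * Real.log p / p) +
        d * N * (Real.log p / ((p : ℝ) * ((p : ℝ) - 1)))) +
        (if p ∈ Δ.primeFactors then W p * N else 0) := by
    intro p hp
    have hp' := (Nat.mem_primesLE.1 hp).2
    have hlog := Real.log_natCast_nonneg p
    have hp1 : (1 : ℝ) < p := by exact_mod_cast hp'.one_lt
    have hp2 : (0 : ℝ) < (p : ℝ) - 1 := by linarith
    have hpos : 0 ≤ d * L + N * ((rootsMod f p).card * Real.log p / p) +
        d * N * (Real.log p / ((p : ℝ) * ((p : ℝ) - 1))) := by positivity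
    by_cases hpΔ : p ∣ Δ
    · rw [if_pos (Nat.mem_primeFactors.2 ⟨hp', hpΔ, hΔ0⟩)]
      refine le_trans ?_ (le_add_of_nonneg_left hpos)
      have h1 := factorization_Qf_mul_log_le h0 hΔ0 hΔ hp' hL0 hL
        (R := Finset.range (p ^ (Δ.factorization p + 1)))
        (fun n _ _ => Finset.mem_range.2 (Nat.mod_lt _ (pow_pos hp'.pos _)))
      refine h1.trans ?_
      rw [Finset.card_range, Nat.cast_pow]
      simp only [W]
      rw [mul_assoc]
      refine mul_le_mul_of_nonneg_left ?_ (by positivity)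
      have h2 : Real.log N ≤ N := Real.log_le_self (by linarith)
      have h3 : L ≤ (Real.log a + d) * N := by
        rw [hLdef]
        have := mul_le_mul_of_nonneg_left h2 (Nat.cast_nonneg (α := ℝ) d)
        nlinarith
      linarith
    · rw [if_neg (fun h => hpΔ (Nat.dvd_of_mem_primeFactors h)), add_zero]
      have hδ : Δ.factorization p = 0 := Nat.factorization_eq_zero_of_not_dvd hpΔ
      have h1 := factorization_Qf_mul_log_le h0 hΔ0 hΔ hp' hL0 hL (R := rootsMod f p)
        (fun n _ h => by
          rw [hδ, zero_add, pow_one]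
          refine Finset.mem_filter.2 ⟨Finset.mem_range.2 (Nat.mod_lt _ hp'.pos), ?_⟩
          have h2 : (p : ℤ) ∣ f.eval (n : ℤ) := Int.natCast_dvd.2 h
          have h3 := f.sub_dvd_eval_sub (n : ℤ) ((n % p : ℕ) : ℤ)
          have h4 : (p : ℤ) ∣ (n : ℤ) - ((n % p : ℕ) : ℤ) := by
            rw [Int.natCast_mod]; exact Int.dvd_self_sub_emod
          exact (dvd_iff_dvd_of_dvd_sub (h4.trans h3)).1 h2)
      rw [hδ, Nat.cast_zero, zero_mul, zero_add] at h1
      refine h1.trans ?_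
      have hρ : ((rootsMod f p).card : ℝ) ≤ d := by exact_mod_cast card_rootsMod_le hf hp'
      -- The first term feeds Nagell's sum, the second a convergent series.
      have e : Real.log p / ((p : ℝ) - 1) =
          Real.log p / p + Real.log p / ((p : ℝ) * ((p : ℝ) - 1)) := by
        field_simp; ring
      rw [e]
      have t1 := mul_le_mul_of_nonneg_right hρ hL0
      have t2 := mul_le_mul_of_nonneg_right hρ
        (show 0 ≤ (N : ℝ) * (Real.log p / ((p : ℝ) * ((p : ℝ) - 1))) by positivity)
      calc _ = (rootsMod f p).card * L + N * ((rootsMod f p).card * Real.log p / p) +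
            (rootsMod f p).card * (N * (Real.log p / ((p : ℝ) * ((p : ℝ) - 1)))) := by ring
        _ ≤ _ := by linarith
  refine (Finset.sum_le_sum hpt).trans ?_
  have hT : 1 ≤ c * N := Nat.mul_pos hc hN
  have hTr : ((c * N : ℕ) : ℝ) = c * N := by push_cast; ring
  have hlT : Real.log ((c * N : ℕ) : ℝ) = Real.log c + Real.log N := by
    rw [hTr, Real.log_mul (by linarith) (by linarith)]
  have hlc : 0 ≤ Real.log c := Real.log_natCast_nonneg c
  rw [Finset.sum_add_distrib, Finset.sum_add_distrib, Finset.sum_add_distrib, Finset.sum_const,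
    nsmul_eq_mul, ← Finset.mul_sum, ← Finset.mul_sum]
  -- Each prime pays `d L = O(log N) + O(1)`, and there are only `O(N / log N)` of them.
  have b1 : ((Nat.primesLE (c * N)).card : ℝ) * (d * L) ≤
      d * (Real.log a + d * (2 * Real.log 4 + 2)) * c * N := by
    have h1 := primeCounting_mul_log_le hT
    have h2 : ((Nat.primesLE (c * N)).card : ℝ) ≤ c * N := by
      rw [← hTr]
      have : (Nat.primesLE (c * N)).card ≤ c * N := by
        calc _ ≤ (Finset.Icc 1 (c * N)).card := Finset.card_le_card fun p hp => by
              rw [Nat.mem_primesLE] at hp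
              exact Finset.mem_Icc.2 ⟨hp.2.one_le, hp.1⟩
          _ = _ := by simp
      exact_mod_cast this
    rw [hlT, hTr] at h1
    have h3 : ((Nat.primesLE (c * N)).card : ℝ) * Real.log N ≤
        (2 * Real.log 4 + 2) * (c * N) := by
      refine le_trans (mul_le_mul_of_nonneg_left ?_ (Nat.cast_nonneg _)) h1
      linarith
    have h4 := mul_le_mul_of_nonneg_right h2 hla
    have hd : (0 : ℝ) ≤ d := Nat.cast_nonneg d
    have h5 : ((Nat.primesLE (c * N)).card : ℝ) * L ≤
        (Real.log a + d * (2 * Real.log 4 + 2)) * c * N := by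
      rw [hLdef]
      have := mul_le_mul_of_nonneg_left h3 hd
      nlinarith
    have := mul_le_mul_of_nonneg_left h5 hd
    linarith
  have b2 := mul_le_mul_of_nonneg_left (hM (c * N) hT) (show (0 : ℝ) ≤ N by linarith)
  rw [hlT] at b2
  have b3 := mul_le_mul_of_nonneg_left (hS (c * N)) (show (0 : ℝ) ≤ d * N by positivity)
  have b4 : ∑ p ∈ Nat.primesLE (c * N), (if p ∈ Δ.primeFactors then W p * N else 0) ≤
      (∑ p ∈ Δ.primeFactors, W p) * N := by
    rw [← Finset.sum_filter, ← Finset.sum_mul]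
    refine mul_le_mul_of_nonneg_right ?_ (by linarith)
    refine Finset.sum_le_sum_of_subset_of_nonneg (fun p hp => (Finset.mem_filter.1 hp).2)
      fun p hp _ => hW p (Nat.prime_of_mem_primeFactors hp)
  linarith

/-! ### Even polynomials as polynomials in `n ^ 2 - s`. -/

theorem exists_expand_two_eq {f : ℤ[X]} (hf : f.Monic) (heven : f.comp (-X) = f) :
    ∃ g : ℤ[X], g.Monic ∧ f.natDegree = 2 * g.natDegree ∧ expand ℤ 2 g = f := by
  have h : expand ℤ 2 (contract 2 f) = f := by
    ext n
    rw [coeff_expand two_pos]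
    split_ifs with hn
    · rw [coeff_contract two_ne_zero, Nat.div_mul_cancel hn]
    · have h1 : f.coeff n = f.coeff n * (-1) ^ n := by
        rw [← comp_C_mul_X_coeff, C_neg, C_1, neg_one_mul, heven]
      rw [Odd.neg_one_pow (Nat.odd_iff.2 (Nat.two_dvd_ne_zero.1 hn))] at h1
      omega
  refine ⟨contract 2 f, ?_, ?_, h⟩
  · rw [← monic_expand_iff two_pos, h]; exact hf
  · conv_lhs => rw [← h, natDegree_expand]
    exact mul_comm _ _

/-- A monic polynomial acquires nonnegative coefficients after a large translation. -/
theorem exists_taylor_coeff_nonneg {g : ℤ[X]} (hg : g.Monic) :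
    ∃ s : ℕ, ∀ i, 0 ≤ (taylor (s : ℤ) g).coeff i := by
  have key : ∀ i ∈ Finset.range g.natDegree, ∀ᶠ s : ℕ in Filter.atTop,
      0 ≤ (taylor (s : ℤ) g).coeff i := by
    intro i hi
    have hi' := Finset.mem_range.1 hi
    -- The `i`-th coefficient of the translate is `P(s)`, and `P` is nonconstant with positive
    -- leading coefficient.
    set P := hasseDeriv i g
    have hdeg : P.natDegree = g.natDegree - i := natDegree_hasseDeriv g i
    have hlead : P.leadingCoeff = (g.natDegree.choose i : ℕ) := by
      rw [leadingCoeff, hdeg, hasseDeriv_coeff, Nat.sub_add_cancel hi'.le, hg.coeff_natDegree,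
        mul_one]
    have hinj : Function.Injective (Int.castRingHom ℝ) := Int.cast_injective
    have h1 : Filter.Tendsto (fun x => eval x (P.map (Int.castRingHom ℝ))) Filter.atTop
        Filter.atTop := by
      refine tendsto_atTop_of_leadingCoeff_nonneg _ ?_ ?_
      · rw [degree_map_eq_of_injective hinj]
        exact natDegree_pos_iff_degree_pos.1 (by omega)
      · rw [leadingCoeff_map_of_injective hinj, hlead]
        simp
    filter_upwards [(h1.comp tendsto_natCast_atTop_atTop).eventually_ge_atTop 0] with s hs
    rw [taylor_coeff]
    have h2 : eval (s : ℝ) (P.map (Int.castRingHom ℝ)) = ((P.eval (s : ℤ) : ℤ) : ℝ) := by simp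
    rw [Function.comp_apply, h2] at hs
    exact_mod_cast hs
  obtain ⟨s, hs⟩ := ((Filter.eventually_all_finset _).2 key).exists
  refine ⟨s, fun i => ?_⟩
  rcases lt_trichotomy i g.natDegree with hi | rfl | hi
  · exact hs i (Finset.mem_range.2 hi)
  · rw [coeff_taylor_natDegree, hg.leadingCoeff]; exact zero_le_one
  · rw [coeff_eq_zero_of_natDegree_lt (by rwa [natDegree_taylor])]

/-- The translation by `s` makes `G` positive and monotone on positive integers, so divisibility of
its divided differences becomes a size bound. -/
theorem exists_eval_eq_eval_sq_sub {f : ℤ[X]} (hf : f.Monic) (heven : f.comp (-X) = f) :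
    ∃ (G : ℤ[X]) (s : ℕ), G.Monic ∧ f.natDegree = 2 * G.natDegree ∧ (∀ i, 0 ≤ G.coeff i) ∧
      ∀ n : ℤ, f.eval n = G.eval (n ^ 2 - s) := by
  obtain ⟨g, hg, hdeg, hgf⟩ := exists_expand_two_eq hf heven
  obtain ⟨s, hs⟩ := exists_taylor_coeff_nonneg hg
  refine ⟨taylor (s : ℤ) g, s, ?_, by rw [natDegree_taylor, hdeg], hs, fun n => ?_⟩
  · rw [Monic, leadingCoeff, natDegree_taylor, coeff_taylor_natDegree, hg.leadingCoeff]
  · rw [taylor_eval, sub_add_cancel, ← expand_eval, hgf]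

theorem pow_natDegree_le_eval {G : ℤ[X]} (hG : G.Monic) (hc : ∀ i, 0 ≤ G.coeff i) {x : ℤ}
    (hx : 0 ≤ x) : x ^ G.natDegree ≤ G.eval x := by
  rw [eval_eq_sum_range, Finset.sum_range_succ, hG.coeff_natDegree, one_mul]
  exact le_add_of_nonneg_left (Finset.sum_nonneg fun i _ => mul_nonneg (hc i) (pow_nonneg hx i))

theorem eval_le_eval_of_coeff_nonneg {G : ℤ[X]} (hc : ∀ i, 0 ≤ G.coeff i) {x y : ℤ}
    (hx : 0 ≤ x) (hxy : x ≤ y) : G.eval x ≤ G.eval y := by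
  rw [eval_eq_sum_range, eval_eq_sum_range]
  exact Finset.sum_le_sum fun i _ =>
    mul_le_mul_of_nonneg_left (pow_le_pow_left₀ hx hxy i) (hc i)

/-! ### Multiplicity of the large primes. -/

/-- If `m` divides the values of `G` at `k + 1` points whose differences are coprime to `m`, then
the divided difference of order `k` bounds `m`. -/
theorem mul_pow_le_eval_of_dvd_eval {m Y : ℤ} (hY : 0 ≤ Y) (k : ℕ) :
    ∀ {G : ℤ[X]} {S : Finset ℤ}, G.Monic → (∀ i, 0 ≤ G.coeff i) → k ≤ G.natDegree →
      S.card = k + 1 → (∀ x ∈ S, 0 < x ∧ x ≤ Y ∧ m ∣ G.eval x) →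
      (∀ x ∈ S, ∀ y ∈ S, x ≠ y → IsCoprime m (x - y)) → m * Y ^ k ≤ G.eval (2 * Y) := by
  induction k with
  | zero =>
    intro G S hG hc _ hS hx _
    obtain ⟨x, hxS⟩ : S.Nonempty := Finset.card_pos.1 (by omega)
    obtain ⟨h0, hxY, hdvd⟩ := hx x hxS
    have h1 : 0 < G.eval x := (pow_pos h0 _).trans_le (pow_natDegree_le_eval hG hc h0.le)
    rw [pow_zero, mul_one]
    exact (Int.le_of_dvd h1 hdvd).trans (eval_le_eval_of_coeff_nonneg hc h0.le (by omega))
  | succ k ih =>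
    intro G S hG hc hk hS hx hco
    obtain ⟨x, hxS⟩ : S.Nonempty := Finset.card_pos.1 (by omega)
    obtain ⟨h0, hxY, hdvd⟩ := hx x hxS
    -- `q(y) = (G(y) - G(x)) / (y - x)` stays monic with nonnegative coefficients because `x > 0`.
    -- Evaluating at `2 * Y` leaves `2 * Y - x ≥ Y`, which gains a factor `Y`.
    set q := G /ₘ (X - C x) with hq
    have hqc : ∀ i, 0 ≤ q.coeff i := fun i => by
      rw [hq, coeff_divByMonic_X_sub_C]
      exact Finset.sum_nonneg fun j _ => mul_nonneg (pow_nonneg h0.le _) (hc j)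
    have hqm : q.Monic := by
      rw [Monic, hq, leadingCoeff_divByMonic_X_sub_C, hG.leadingCoeff]
      exact (natDegree_pos_iff_degree_pos.1 (by omega)).ne'
    have hqd : q.natDegree = G.natDegree - 1 := by
      rw [hq, natDegree_divByMonic _ (monic_X_sub_C x), natDegree_X_sub_C]
    have hqe : ∀ y, (y - x) * q.eval y = G.eval y - G.eval x := fun y => by
      have h1 := modByMonic_add_div G (X - C x)
      rw [modByMonic_X_sub_C_eq_C_eval] at h1
      have h2 := congrArg (eval y) h1
      simp only [eval_add, eval_C, eval_mul, eval_sub, eval_X] at h2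
      rw [← h2]; ring
    have h1 := ih (G := q) (S := S.erase x) hqm hqc (by omega)
      (by rw [Finset.card_erase_of_mem hxS]; omega)
      (fun y hy => by
        obtain ⟨hne, hyS⟩ := Finset.mem_erase.1 hy
        obtain ⟨hy0, hyY, hydvd⟩ := hx y hyS
        refine ⟨hy0, hyY, (hco y hyS x hxS hne).dvd_of_dvd_mul_left ?_⟩
        rw [hqe]
        exact dvd_sub hydvd hdvd)
      (fun y hy z hz => hco y (Finset.mem_of_mem_erase hy) z (Finset.mem_of_mem_erase hz))
    have h2 := hqe (2 * Y)
    have h3 : 0 ≤ q.eval (2 * Y) :=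
      (pow_nonneg (by omega) _).trans (pow_natDegree_le_eval hqm hqc (by omega))
    have h4 : 0 ≤ G.eval x := (pow_nonneg h0.le _).trans (pow_natDegree_le_eval hG hc h0.le)
    calc m * Y ^ (k + 1) = Y * (m * Y ^ k) := by ring
      _ ≤ Y * q.eval (2 * Y) := mul_le_mul_of_nonneg_left h1 hY
      _ ≤ (2 * Y - x) * q.eval (2 * Y) := mul_le_mul_of_nonneg_right (by omega) h3
      _ ≤ G.eval (2 * Y) := by omega

theorem exists_eval_two_mul_le (G : ℤ[X]) :
    ∃ A : ℕ, ∀ Y : ℕ, 1 ≤ Y → G.eval (2 * (Y : ℤ)) ≤ A * (Y : ℤ) ^ G.natDegree := by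
  refine ⟨⌈(1 + ∑ i ∈ Finset.range (G.natDegree + 1), |(G.coeff i : ℝ)|) * 2 ^ G.natDegree⌉₊,
    fun Y hY => ?_⟩
  have h1 := natAbs_eval_le G (n := 2 * Y) le_rfl (by omega)
  have h2 := Nat.le_ceil
    ((1 + ∑ i ∈ Finset.range (G.natDegree + 1), |(G.coeff i : ℝ)|) * 2 ^ G.natDegree)
  set a : ℝ := 1 + ∑ i ∈ Finset.range (G.natDegree + 1), |(G.coeff i : ℝ)|
  set A := ⌈a * 2 ^ G.natDegree⌉₊
  have h3 : ((G.eval ((2 * Y : ℕ) : ℤ)).natAbs : ℝ) ≤ A * (Y : ℝ) ^ G.natDegree := by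
    refine h1.trans ?_
    rw [Nat.cast_mul, mul_pow, ← mul_assoc]
    exact mul_le_mul_of_nonneg_right (by exact_mod_cast h2) (by positivity)
  have h4 : (G.eval ((2 * Y : ℕ) : ℤ)).natAbs ≤ A * Y ^ G.natDegree := by exact_mod_cast h3
  have h5 : G.eval (2 * (Y : ℤ)) ≤ (G.eval ((2 * Y : ℕ) : ℤ)).natAbs := by
    push_cast
    exact le_abs_self _
  refine h5.trans ?_
  exact_mod_cast h4

/-- For a large prime `p`, few arguments `n ≤ N` have `p ^ a ∣ f n`. -/
theorem exists_two_mul_card_add_le {f : ℤ[X]} (hf : f.Monic) (hirr : Irreducible f)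
    (hdeg : 2 ≤ f.natDegree) (heven : f.comp (-X) = f) :
    ∃ c : ℕ, 1 ≤ c ∧ ∀ N : ℕ, 1 ≤ N → ∀ p : ℕ, p.Prime → c * N < p → ∀ a : ℕ, 1 ≤ a →
      ((Finset.Icc 1 N).filter fun n : ℕ => p ^ a ∣ (f.eval (n : ℤ)).natAbs).Nonempty →
      2 * ((Finset.Icc 1 N).filter fun n : ℕ => p ^ a ∣ (f.eval (n : ℤ)).natAbs).card + a ≤
        f.natDegree + 1 := by
  classical
  have h0 := eval_ne_zero_of_irreducible hirr hdeg
  obtain ⟨G, s, hG, hd, hc, he⟩ := exists_eval_eq_eval_sq_sub hf heven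
  obtain ⟨A, hA⟩ := exists_eval_two_mul_le G
  set B := ∑ n ∈ Finset.range (s + 1), (f.eval (n : ℤ)).natAbs
  -- `A` gives `p ^ a > A N ^ a`; `B` excludes the arguments with `n ^ 2 ≤ s`; `2` gives `p > 2 N`,
  -- so that `p` divides no `n ± m`.
  refine ⟨A + B + 2, by omega, fun N hN p hp hpN a ha hne => ?_⟩
  set T := (Finset.Icc 1 N).filter fun n : ℕ => p ^ a ∣ (f.eval (n : ℤ)).natAbs
  set D := G.natDegree
  have hpZ : Prime (p : ℤ) := Nat.prime_iff_prime_int.1 hp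
  have hcN : A + B + 2 ≤ (A + B + 2) * N := Nat.le_mul_of_pos_right _ hN
  have h2N : 2 * N < p := lt_of_le_of_lt (Nat.mul_le_mul_right N (by omega)) hpN
  have hs : ∀ n ∈ T, s < n ^ 2 := by
    intro n hn
    by_contra! hns
    have hn' := (Finset.mem_filter.1 hn).2
    have hnle : n ≤ s := (Nat.le_self_pow two_ne_zero n).trans hns
    have h1 : (f.eval (n : ℤ)).natAbs ≤ B :=
      Finset.single_le_sum (f := fun n : ℕ => (f.eval (n : ℤ)).natAbs) (fun _ _ => Nat.zero_le _)
        (Finset.mem_range.2 (by omega))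
    have h2 := Nat.le_of_dvd (Int.natAbs_pos.2 (h0 n)) ((dvd_pow_self p (by omega)).trans hn')
    omega
  -- At most `D` divided differences are available. The capped case `k = D` is refuted at the end by
  -- `a + 2 * k < 2 * D`.
  obtain ⟨k, hk, hkT⟩ : ∃ k, k ≤ D ∧ (T.card = k + 1 ∨ (k = D ∧ D + 1 ≤ T.card)) := by
    have := Finset.card_pos.2 hne
    rcases le_or_gt T.card (D + 1) with h | h
    · exact ⟨T.card - 1, by omega, Or.inl (by omega)⟩
    · exact ⟨D, le_rfl, Or.inr ⟨rfl, h.le⟩⟩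
  obtain ⟨U, hUT, hU⟩ : ∃ U ⊆ T, U.card = k + 1 :=
    Finset.exists_subset_card_eq (by omega)
  have hinj : Set.InjOn (fun n : ℕ => (n : ℤ) ^ 2 - s) U := by
    intro n _ m _ h
    have h1 : (n : ℤ) ^ 2 = (m : ℤ) ^ 2 := by simpa using h
    have h2 : n ^ 2 = m ^ 2 := by exact_mod_cast h1
    exact Nat.pow_left_injective two_ne_zero h2
  have hbound := mul_pow_le_eval_of_dvd_eval (m := (p : ℤ) ^ a) (Y := ((N ^ 2 : ℕ) : ℤ))
    (Int.natCast_nonneg _) k (G := G) (S := U.image fun n : ℕ => (n : ℤ) ^ 2 - s) hG hc hk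
    (by rw [Finset.card_image_of_injOn hinj, hU])
    (fun x hx => by
      obtain ⟨n, hn, rfl⟩ := Finset.mem_image.1 hx
      have hnT := hUT hn
      have h1 := hs n hnT
      have h2 : n ^ 2 ≤ N ^ 2 :=
        Nat.pow_le_pow_left (Finset.mem_Icc.1 (Finset.mem_filter.1 hnT).1).2 2
      have h1' : (s : ℤ) < (n : ℤ) ^ 2 := by exact_mod_cast h1
      have h2' : (n : ℤ) ^ 2 ≤ ((N ^ 2 : ℕ) : ℤ) := by exact_mod_cast h2
      refine ⟨by omega, by omega, ?_⟩
      rw [← he, ← Nat.cast_pow]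
      exact Int.natCast_dvd.2 (Finset.mem_filter.1 hnT).2)
    (fun x hx y hy hxy => by
      obtain ⟨n, hn, rfl⟩ := Finset.mem_image.1 hx
      obtain ⟨m, hm, rfl⟩ := Finset.mem_image.1 hy
      have hn' := Finset.mem_Icc.1 (Finset.mem_filter.1 (hUT hn)).1
      have hm' := Finset.mem_Icc.1 (Finset.mem_filter.1 (hUT hm)).1
      refine IsCoprime.pow_left ((Prime.coprime_iff_not_dvd hpZ).2 fun hdvd => ?_)
      have e : (n : ℤ) ^ 2 - s - ((m : ℤ) ^ 2 - s) = ((n : ℤ) - m) * ((n : ℤ) + m) := by ring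
      rw [e] at hdvd
      have hnm : (n : ℤ) ≠ m := fun h => hxy (by simp only [h])
      rcases hpZ.dvd_or_dvd hdvd with h | h
      · have := Int.eq_zero_of_abs_lt_dvd h (by rw [abs_lt]; constructor <;> omega)
        omega
      · have := Int.eq_zero_of_abs_lt_dvd h (by rw [abs_lt]; constructor <;> omega)
        omega)
  have hbound2 := hbound.trans (hA (N ^ 2) (Nat.pow_pos hN))
  have hbound3 : p ^ a * (N ^ 2) ^ k ≤ A * (N ^ 2) ^ D := by exact_mod_cast hbound2
  have hpa : A * N ^ a < p ^ a := by
    calc A * N ^ a ≤ (A + B + 2) ^ a * N ^ a :=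
          Nat.mul_le_mul_right _ (le_trans (by omega) (Nat.le_self_pow (by omega) (A + B + 2)))
      _ = ((A + B + 2) * N) ^ a := (mul_pow _ _ _).symm
      _ < p ^ a := Nat.pow_lt_pow_left hpN (by omega)
  have hlt : A * N ^ (a + 2 * k) < A * N ^ (2 * D) := by
    calc A * N ^ (a + 2 * k) = A * N ^ a * (N ^ 2) ^ k := by rw [pow_add, pow_mul]; ring
      _ < p ^ a * (N ^ 2) ^ k :=
        Nat.mul_lt_mul_of_pos_right hpa (Nat.pow_pos (Nat.pow_pos hN))
      _ ≤ A * (N ^ 2) ^ D := hbound3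
      _ = A * N ^ (2 * D) := by rw [pow_mul]
  have hexp : a + 2 * k < 2 * D := by
    by_contra! h
    exact absurd hlt (not_lt.2 (Nat.mul_le_mul_left _ (Nat.pow_le_pow_right hN h)))
  omega

/-- The terms are `D, D - 1, D - 1, ..., 1, 1, 0`. -/
theorem sum_Icc_add_one_sub_div_two (D : ℕ) :
    ∑ a ∈ Finset.Icc 1 (2 * D), (2 * D + 1 - a) / 2 = D ^ 2 := by
  have h : ∀ D : ℕ, ∑ b ∈ Finset.range (2 * D), (b + 1) / 2 = D ^ 2 := by
    intro D
    induction D with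
    | zero => simp
    | succ D ih =>
      rw [show 2 * (D + 1) = 2 * D + 1 + 1 by ring, Finset.sum_range_succ,
        Finset.sum_range_succ, ih, show (2 * D + 1) / 2 = D by omega,
        show (2 * D + 1 + 1) / 2 = D + 1 by omega]
      ring
  rw [← h D, ← Finset.sum_range_reflect]
  refine (Finset.sum_bij (fun b _ => b + 1) ?_ ?_ ?_ ?_).symm
  · intro b hb
    rw [Finset.mem_range] at hb
    exact Finset.mem_Icc.2 (by omega)
  · intro b _ b' _ hbb
    omega
  · intro a ha
    rw [Finset.mem_Icc] at ha
    exact ⟨a - 1, Finset.mem_range.2 (by omega), by omega⟩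
  · intro b hb
    rw [Finset.mem_range] at hb
    congr 1
    omega

/-- A large prime divides `Q_f(N)` with multiplicity at most `(d / 2) ^ 2`. -/
theorem exists_four_mul_factorization_Qf_le {f : ℤ[X]} (hf : f.Monic) (hirr : Irreducible f)
    (hdeg : 2 ≤ f.natDegree) (heven : f.comp (-X) = f) :
    ∃ c : ℕ, 1 ≤ c ∧ ∀ N : ℕ, 1 ≤ N → ∀ p : ℕ, p.Prime → c * N < p →
      4 * (Qf f N).factorization p ≤ f.natDegree ^ 2 := by
  classical
  have h0 := eval_ne_zero_of_irreducible hirr hdeg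
  obtain ⟨G, -, -, hd, -⟩ := exists_eval_eq_eval_sq_sub hf heven
  set D := G.natDegree
  obtain ⟨c, hc, hmain⟩ := exists_two_mul_card_add_le hf hirr hdeg heven
  refine ⟨c, hc, fun N hN p hp hpN => ?_⟩
  have hcard : ∀ a, 1 ≤ a →
      ((Finset.Icc 1 N).filter fun n : ℕ => p ^ a ∣ (f.eval (n : ℤ)).natAbs).card ≤
        (2 * D + 1 - a) / 2 := by
    intro a ha
    rcases ((Finset.Icc 1 N).filter
      fun n : ℕ => p ^ a ∣ (f.eval (n : ℤ)).natAbs).eq_empty_or_nonempty with h | h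
    · rw [h]; exact Nat.zero_le _
    · have := hmain N hN p hp hpN a ha h
      omega
  -- A valuation counts the exponents `a` with `p ^ a` dividing; `2 * D` suffices since no `n`
  -- survives at `a = 2 * D + 1`.
  have hval : ∀ n ∈ Finset.Icc 1 N, (f.eval (n : ℤ)).natAbs.factorization p =
      ∑ a ∈ Finset.Icc 1 (2 * D), if p ^ a ∣ (f.eval (n : ℤ)).natAbs then 1 else 0 := by
    intro n hn
    have hne := Int.natAbs_ne_zero.2 (h0 n)
    rw [← Finset.card_filter]
    have hle : (f.eval (n : ℤ)).natAbs.factorization p ≤ 2 * D := by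
      by_contra! h
      have h1 : n ∈ (Finset.Icc 1 N).filter
          fun n : ℕ => p ^ (2 * D + 1) ∣ (f.eval (n : ℤ)).natAbs :=
        Finset.mem_filter.2 ⟨hn, (hp.pow_dvd_iff_le_factorization hne).2 h⟩
      have h2 := Finset.card_pos.2 ⟨n, h1⟩
      have h3 := hcard (2 * D + 1) (by omega)
      omega
    have : ((Finset.Icc 1 (2 * D)).filter fun a => p ^ a ∣ (f.eval (n : ℤ)).natAbs) =
        Finset.Icc 1 ((f.eval (n : ℤ)).natAbs.factorization p) := by
      ext a
      rw [Finset.mem_filter, hp.pow_dvd_iff_le_factorization hne, Finset.mem_Icc,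
        Finset.mem_Icc]
      omega
    rw [this]; simp
  rw [factorization_Qf h0, Finset.sum_congr rfl hval, Finset.sum_comm]
  calc _ ≤ 4 * ∑ a ∈ Finset.Icc 1 (2 * D), (2 * D + 1 - a) / 2 := by
        refine Nat.mul_le_mul_left _ (Finset.sum_le_sum fun a ha => ?_)
        rw [← Finset.card_filter]
        exact hcard a (Finset.mem_Icc.1 ha).1
    _ = f.natDegree ^ 2 := by rw [sum_Icc_add_one_sub_div_two, hd]; ring

/-! ### Lower bound for `log Q_f(N)` and conclusion. -/

theorem mul_log_sub_le_log_factorial {N : ℕ} (hN : 1 ≤ N) :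
    N * Real.log N - N ≤ Real.log (N.factorial) := by
  have h := Stirling.le_log_factorial_stirling (n := N) (by omega)
  have h1 : 0 ≤ Real.log N := Real.log_natCast_nonneg N
  have h2 : 0 ≤ Real.log (2 * Real.pi) := Real.log_nonneg (by linarith [Real.pi_gt_three])
  linarith

/-- `log Q_f(N)` is at least `d N log N - O(N)`. -/
theorem exists_le_log_Qf {f : ℤ[X]} (hf : f.Monic) (hirr : Irreducible f)
    (hdeg : 2 ≤ f.natDegree) (heven : f.comp (-X) = f) :
    ∃ C : ℝ, ∀ N : ℕ, 1 ≤ N →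
      f.natDegree * (N * Real.log N) - C * N ≤ Real.log (Qf f N) := by
  have h0 := eval_ne_zero_of_irreducible hirr hdeg
  obtain ⟨G, s, hG, hd, hc, he⟩ := exists_eval_eq_eval_sq_sub hf heven
  set D := G.natDegree
  have hs1 : (0 : ℝ) < s + 1 := by positivity
  have hpt : ∀ n : ℕ, 1 ≤ n → f.natDegree * Real.log n - D * Real.log (s + 1) ≤
      Real.log (f.eval (n : ℤ)).natAbs := by
    intro n hn
    have hn0 : (0 : ℝ) < n := by exact_mod_cast hn
    have hpos : 0 < (f.eval (n : ℤ)).natAbs := Int.natAbs_pos.2 (h0 n)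
    -- For `n ^ 2 > s` use `n ^ 2 ≤ (s + 1)(n ^ 2 - s)`; otherwise `(s + 1) ^ D` alone suffices, as
    -- `f n ≠ 0`.
    have hkey : ((n : ℝ) ^ 2) ^ D ≤ (s + 1) ^ D * (f.eval (n : ℤ)).natAbs := by
      have : (n ^ 2) ^ D ≤ (s + 1) ^ D * (f.eval (n : ℤ)).natAbs := by
        rcases le_or_gt (n ^ 2) s with h | h
        · calc (n ^ 2) ^ D ≤ (s + 1) ^ D := Nat.pow_le_pow_left (by omega) D
            _ ≤ _ := Nat.le_mul_of_pos_right _ hpos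
        · obtain ⟨t, ht⟩ : ∃ t, n ^ 2 = s + t := ⟨n ^ 2 - s, by omega⟩
          have ht1 : 1 ≤ t := by omega
          have h1 : t ^ D ≤ (f.eval (n : ℤ)).natAbs := by
            have h2 := pow_natDegree_le_eval hG hc (x := t) (Int.natCast_nonneg t)
            have h3 : (n : ℤ) ^ 2 - s = t := by
              have : ((n ^ 2 : ℕ) : ℤ) = s + t := by rw [ht]; push_cast; ring
              push_cast at this
              linarith
            have h4 := he n
            rw [h3] at h4
            have h5 : (t : ℤ) ^ D ≤ (f.eval (n : ℤ)).natAbs := by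
              rw [h4]; exact h2.trans Int.le_natAbs
            exact_mod_cast h5
          calc (n ^ 2) ^ D ≤ ((s + 1) * t) ^ D := Nat.pow_le_pow_left (by nlinarith) D
            _ = (s + 1) ^ D * t ^ D := mul_pow _ _ _
            _ ≤ _ := Nat.mul_le_mul_left _ h1
      exact_mod_cast this
    have h1 := Real.log_le_log (by positivity) hkey
    rw [Real.log_mul (by positivity) (by exact_mod_cast hpos.ne'), Real.log_pow, Real.log_pow,
      Real.log_pow] at h1
    rw [hd]
    push_cast at h1 ⊢
    linarith
  refine ⟨f.natDegree + D * Real.log (s + 1), fun N hN => ?_⟩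
  have hQ : Qf f N = ∏ n ∈ Finset.Icc 1 N, (f.eval (n : ℤ)).natAbs :=
    map_prod Int.natAbsHom _ _
  rw [hQ, Nat.cast_prod, Real.log_prod (fun n _ => by
    exact_mod_cast Int.natAbs_ne_zero.2 (h0 n))]
  have h1 := Finset.sum_le_sum fun n (hn : n ∈ Finset.Icc 1 N) => hpt n (Finset.mem_Icc.1 hn).1
  refine le_trans ?_ h1
  have h2 : ∑ n ∈ Finset.Icc 1 N, Real.log n = Real.log (N.factorial) := by
    rw [← Finset.prod_Ico_id_eq_factorial, ← Finset.Ico_add_one_right_eq_Icc, Nat.cast_prod, Real.log_prod]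
    intro n hn
    have := (Finset.mem_Ico.1 hn).1
    exact_mod_cast (by omega : n ≠ 0)
  rw [Finset.sum_sub_distrib, ← Finset.mul_sum, h2, Finset.sum_const, Nat.card_Icc,
    Nat.add_sub_cancel, nsmul_eq_mul]
  have := mul_le_mul_of_nonneg_left (mul_log_sub_le_log_factorial hN)
    (Nat.cast_nonneg (α := ℝ) f.natDegree)
  linarith

theorem log_ellf {f : ℤ[X]} (N : ℕ) :
    Real.log (ellf f N) = ∑ p ∈ (Qf f N).primeFactors, Real.log p := by
  rw [ellf_eq_radical_Qf, Nat.radical_eq_prod_primeFactors, Nat.cast_prod, Real.log_prod]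
  exact fun p hp => by exact_mod_cast (Nat.prime_of_mem_primeFactors hp).ne_zero

/-- The part of `log Q_f(N)` left after removing primes up to `c N` is at most `d ^ 2 / 4` times
`log ℓ_f(N)`. -/
theorem exists_sq_mul_log_ellf_ge {f : ℤ[X]} (hf : f.Monic) (hirr : Irreducible f)
    (hdeg : 2 ≤ f.natDegree) (heven : f.comp (-X) = f) :
    ∃ C : ℝ, 0 ≤ C ∧ ∀ N : ℕ, 1 ≤ N →
      4 * ((f.natDegree : ℝ) - 1) * (N * Real.log N) - C * N ≤
        (f.natDegree : ℝ) ^ 2 * Real.log (ellf f N) := by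
  classical
  obtain ⟨c, hc, hlarge⟩ := exists_four_mul_factorization_Qf_le hf hirr hdeg heven
  obtain ⟨C₁, hC₁⟩ := exists_sum_factorization_Qf_mul_log_le hf hirr hdeg hc
  obtain ⟨C₂, hC₂⟩ := exists_le_log_Qf hf hirr hdeg heven
  refine ⟨max 0 (4 * (C₁ + C₂)), le_max_left _ _, fun N hN => ?_⟩
  have h1 := hC₁ N hN
  have h2 := hC₂ N hN
  set Q := Qf f N
  set d := f.natDegree
  have hQlog : Real.log Q = ∑ p ∈ Q.primeFactors, (Q.factorization p : ℝ) * Real.log p := by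
    rw [Real.log_nat_eq_sum_factorization, Finsupp.sum, Nat.support_factorization]
  have hsplit := Finset.sum_filter_add_sum_filter_not Q.primeFactors (fun p => p ≤ c * N)
    (fun p => (Q.factorization p : ℝ) * Real.log p)
  have hsmall : ∑ p ∈ Q.primeFactors.filter (fun p => p ≤ c * N),
      (Q.factorization p : ℝ) * Real.log p ≤
      ∑ p ∈ Nat.primesLE (c * N), (Q.factorization p : ℝ) * Real.log p := by
    refine Finset.sum_le_sum_of_subset_of_nonneg (fun p hp => ?_) fun p _ _ =>
      mul_nonneg (Nat.cast_nonneg _) (Real.log_natCast_nonneg p)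
    rw [Finset.mem_filter] at hp
    exact Nat.mem_primesLE.2 ⟨hp.2, Nat.prime_of_mem_primeFactors hp.1⟩
  have hbig : 4 * ∑ p ∈ Q.primeFactors.filter (fun p => ¬ p ≤ c * N),
      (Q.factorization p : ℝ) * Real.log p ≤ (d : ℝ) ^ 2 * Real.log (ellf f N) := by
    rw [log_ellf, Finset.mul_sum, Finset.mul_sum]
    refine le_trans (Finset.sum_le_sum fun p hp => ?_)
      (Finset.sum_le_sum_of_subset_of_nonneg (Finset.filter_subset _ _) fun p _ _ =>
        mul_nonneg (by positivity) (Real.log_natCast_nonneg p))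
    rw [Finset.mem_filter] at hp
    have h3 := hlarge N hN p (Nat.prime_of_mem_primeFactors hp.1) (not_le.1 hp.2)
    have h4 : 4 * (Q.factorization p : ℝ) ≤ (d : ℝ) ^ 2 := by exact_mod_cast h3
    have := mul_le_mul_of_nonneg_right h4 (Real.log_natCast_nonneg p)
    linarith
  have hC : 4 * (C₁ + C₂) * N ≤ max 0 (4 * (C₁ + C₂)) * N :=
    mul_le_mul_of_nonneg_right (le_max_right _ _) (Nat.cast_nonneg N)
  linarith

theorem mainTheorem2 (f : ℤ[X]) (hmonic : f.Monic) (hirr : Irreducible f)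
    (hdeg : 2 ≤ f.natDegree) (heven : f.comp (-X) = f) :
    (∃ C : ℝ, ∀ N : ℕ, 1 ≤ N →
      8 * ((f.natDegree : ℝ) - 1) / ((f.natDegree : ℝ) * (3 * (f.natDegree : ℝ) - 2))
          * ((N : ℝ) * Real.log (N : ℝ)) - C * (N : ℝ)
        ≤ Real.log (ellf f N : ℝ)) ∧
    (2 < f.natDegree →
      2 / (f.natDegree : ℝ) <
        8 * ((f.natDegree : ℝ) - 1) / ((f.natDegree : ℝ) * (3 * (f.natDegree : ℝ) - 2))) := by
  have hd : (2 : ℝ) ≤ f.natDegree := by exact_mod_cast hdeg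
  refine ⟨?_, fun h => ?_⟩
  · obtain ⟨C, hC0, hC⟩ := exists_sq_mul_log_ellf_ge hmonic hirr hdeg heven
    refine ⟨C, fun N hN => ?_⟩
    have h := hC N hN
    have hN0 : (0 : ℝ) ≤ N := Nat.cast_nonneg N
    have hX : 0 ≤ (N : ℝ) * Real.log N := mul_nonneg hN0 (Real.log_natCast_nonneg N)
    generalize (f.natDegree : ℝ) = d at hd h ⊢
    generalize (N : ℝ) * Real.log N = x at h hX ⊢
    have hd2 : (0 : ℝ) < d ^ 2 := by positivity
    have h1 : (4 * (d - 1) * x - C * N) / d ^ 2 ≤ Real.log (ellf f N) := by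
      rw [div_le_iff₀ hd2]; linarith
    refine le_trans ?_ h1
    -- Equivalent to `2 d ≤ 3 d - 2`; equality holds at `d = 2`.
    have hcoef : 8 * (d - 1) / (d * (3 * d - 2)) ≤ 4 * (d - 1) / d ^ 2 := by
      rw [div_le_div_iff₀ (by nlinarith) hd2]
      nlinarith [mul_nonneg (mul_nonneg (show 0 ≤ d by linarith) (show 0 ≤ d - 1 by linarith))
        (show 0 ≤ d - 2 by linarith)]
    have h2 : C * N / d ^ 2 ≤ C * N :=
      div_le_self (mul_nonneg hC0 hN0) (by nlinarith)
    have h3 := mul_le_mul_of_nonneg_right hcoef hX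
    rw [sub_div, mul_div_right_comm (4 * (d - 1)) x]
    linarith
  · have h' : (2 : ℝ) < f.natDegree := by exact_mod_cast h
    generalize (f.natDegree : ℝ) = d at h' hd ⊢
    rw [div_lt_div_iff₀ (by linarith) (by nlinarith)]
    nlinarith [mul_pos (show 0 < d by linarith) (show 0 < d - 2 by linarith)]
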